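/- Let $n,m\ge 1$ and let $\mathbb F_n^+$ be the free semigroup (with identity $g_0$) on $g_1,\dots,g_n$. For $X=(X_1,\dots,X_n)\in B(\mathcal H)^n$ write $X_\alpha=X_{i_1}\cdots X_{i_k}$ if $\alpha=g_{i_1}\cdots g_{i_k}$, and $X_{g_0}=I$. Let $f=\sum_{\alpha}a_\alpha X_\alpha$ be a positive regular free holomorphic function on $[B(\mathcal H)^n]_\rho=\{X:\|\sum_i X_iX_i^*\|<\rho\}$ for some $\rho>0$, i.e. $a_\alpha\ge 0$, $a_{g_0}=0$, $a_{g_i}>0$ for $i=1,\dots,n$, and $\sum_{k}\sum_{|\alpha|=k}a_\alpha X_\alpha$ converges in norm for all $X\in[B(\mathcal H)^n]_\rho$. Put $\Phi_{f,X}(Y)=\sum_{|\alpha|\ge1}a_\alpha X_\alpha YX_\alpha^*$ (weak operator convergence), and let $\mathbf D_f^m(\mathcal H)$ be the set of $X\in B(\mathcal H)^n$ for which $\sum_{|\alpha|\geq 1} a_\alpha X_\alpha X_\alpha^*$ converges weakly and $(\mathrm{id}-\Phi_{f,X})^k(I)\ge0$ for $1\le k\le m$. For a set $\mathcal Q$ of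 noncommutative polynomials in $n$ indeterminates put $\mathcal V^m_{f,\mathcal Q}(\mathcal H)=\{X\in\mathbf D_f^m(\mathcal H): q(X)=0\text{ for all }q\in\mathcal Q\}$. Let $b_{g_0}=1$ and, for $|\alpha|\ge1$, $b_\alpha=\sum_{j=1}^{|\alpha|}\binom{j+m-1}{m-1}\sum_{\gamma_1\cdots\gamma_j=\alpha,\ |\gamma_i|\ge1}a_{\gamma_1}\cdots a_{\gamma_j}$. On the full Fock space $F^2(H_n)$, with orthonormal basis $\{e_\alpha\}_{\alpha\in\mathbb F_n^+}$ and $1=e_{g_0}$, let $W_ie_\alpha=\sqrt{b_\alpha/b_{g_i\alpha}}\,e_{g_i\alpha}$. Let $\mathcal M_{\mathcal Q}=\overline{\mathrm{span}}\{W_\alpha q(W_1,\dots,W_n)W_\beta 1:\ q\in\mathcal Q,\ \alpha,\beta\in\mathbb F_n^+\}$, $\mathcal N_{\mathcal Q}=F^2(H_n)\ominus\mathcal M_{\mathcal Q}$ and $B_i=P_{\mathcal N_{\mathcal Q}}W_i|_{\mathcal N_{\mathcal Q}}$. Assume $\mathcal N_{\mathcal Q}\ne\{0\}$. **Theorem.**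 Let $\mathcal H$ be a complex Hilbert space, $T=(T_1,\dots,T_n)\in\mathcal V^m_{f,\mathcal Q}(\mathcal H)$, $\Delta_{f,m,T}=[(\mathrm{id}-\Phi_{f,T})^m(I)]^{1/2}$ and $\mathcal D=\overline{\Delta_{f,m,T}\mathcal H}$. Then there exist a Hilbert space $\mathcal K$ and $U=(U_1,\dots,U_n)\in\mathcal V^m_{f,\mathcal Q}(\mathcal K)$ with $\Phi_{f,U}(I_{\mathcal K})=I_{\mathcal K}$ such that: (i) $\mathcal H$ can be identified, through a linear isometry, with a subspace of $\widetilde{\mathcal K}=(\mathcal N_{\mathcal Q}\otimes\mathcal D)\oplus\mathcal K$ that is co-invariant under the operators $V_i=(B_i\otimes I_{\mathcal D})\oplus U_i$, i.e. invariant under $V_i^*$, $i=1,\dots,n$; (ii) under this identification $T_i^*=V_i^*|_{\mathcal H}$ for $i=1,\dots,n$. Moreover, this $\mathcal K$ is $\{0\}$ if and only if $T$ is pure, i.e. $\Phi_{f,T}^k(I)\to0$ strongly as $k\to\infty$. -/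

import Mathlib

open scoped TensorProduct InnerProductSpace
open Filter Topology

universe u

noncomputable section

namespace NCVariety

/-! ### Words, monomials and polynomials

The free semigroup on `n` generators is `FreeMonoid (Fin n)`; noncommutative polynomials in `n`
indeterminates are the elements of `FreeAlgebra ℂ (Fin n)`. -/

section Monomials

variable {n : ℕ} {H : Type*} [NormedAddCommGroup H] [InnerProductSpace ℂ H]

/-- The monomial `X_α = X_{i₁} ⋯ X_{i_k}` for the word `α = g_{i₁} ⋯ g_{i_k}`. -/
def monomial (X : Fin n → H →L[ℂ] H) (α : FreeMonoid (Fin n)) : H →L[ℂ] H :=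
  FreeMonoid.lift X α

/-- The value `q(X₁, …, Xₙ)` of a noncommutative polynomial. -/
def polyEval (X : Fin n → H →L[ℂ] H) (q : FreeAlgebra ℂ (Fin n)) : H →L[ℂ] H :=
  FreeAlgebra.lift ℂ X q

end Monomials

/-! ### Positive regular free holomorphic functions -/

/-- A formal power series `f = ∑ a_α X_α` in `n` noncommuting indeterminates whose coefficients
satisfy the positive regularity conditions. Convergence is `IsFreeHolomorphicOn`. -/
structure PosRegular (n : ℕ) where
  /-- the coefficients `a_α` -/
  coeff : FreeMonoid (Fin n) → ℝ
  coeff_nonneg : ∀ α, 0 ≤ coeff α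
  coeff_one : coeff 1 = 0
  coeff_of_pos : ∀ i, 0 < coeff (FreeMonoid.of i)

namespace PosRegular

variable {n : ℕ} (f : PosRegular n)

/-- `f` is free holomorphic on the ball `{X ∈ B(H)ⁿ : ‖∑ X_i X_i^*‖ < ρ}`: for every `X` in it the
series `∑_k ∑_{|α| = k} a_α X_α` converges in the operator norm. The words of length `k` are listed
as functions `Fin k → Fin n`. -/
def IsFreeHolomorphicOn (H : Type*) [NormedAddCommGroup H] [InnerProductSpace ℂ H]
    [CompleteSpace H] (ρ : ℝ) : Prop :=
  ∀ X : Fin n → H →L[ℂ] H, ‖∑ i, X i * star (X i)‖ < ρ →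
    ∃ S : H →L[ℂ] H, Tendsto
      (fun N : ℕ => ∑ k ∈ Finset.range N, ∑ w : Fin k → Fin n,
        (f.coeff (FreeMonoid.ofList (List.ofFn w)) : ℂ) •
          monomial X (FreeMonoid.ofList (List.ofFn w)))
      atTop (𝓝 S)

/-- The summand of `b_α^{(m)}` that belongs to the factorization `α = γ₁ ⋯ γ_j` into nonempty words
which is given by the composition `c` of `|α|`. -/
def bTerm (m : ℕ) (l : List (Fin n)) (c : Composition l.length) : ℝ :=
  ((l.splitWrtComposition c).map fun γ => f.coeff (FreeMonoid.ofList γ)).prod *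
    ((c.length + m - 1).choose (m - 1) : ℝ)

/-- `b_α^{(m)} = ∑_j ∑_{γ₁ ⋯ γ_j = α, |γ_i| ≥ 1} a_{γ₁} ⋯ a_{γ_j} * (j + m - 1).choose (m - 1)`.
For the empty word there is just the empty factorization, and the value is `1`. -/
def b (m : ℕ) (α : FreeMonoid (Fin n)) : ℝ :=
  ∑ c : Composition α.toList.length, f.bTerm m α.toList c

lemma bTerm_nonneg (m : ℕ) (l : List (Fin n)) (c : Composition l.length) :
    0 ≤ f.bTerm m l c := by
  refine mul_nonneg (List.prod_nonneg ?_) (Nat.cast_nonneg _)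
  intro x hx
  obtain ⟨γ, -, rfl⟩ := List.mem_map.1 hx
  exact f.coeff_nonneg _

/-- Prepending a block of size `1` to a composition. -/
def consOne {k : ℕ} : Composition k ↪ Composition (k + 1) where
  toFun c := ⟨1 :: c.blocks, by
    intro i hi
    rcases List.mem_cons.1 hi with rfl | hi
    · exact one_pos
    · exact c.blocks_pos hi, by rw [List.sum_cons, c.blocks_sum, add_comm]⟩
  inj' c d h := by
    have := congrArg Composition.blocks h
    exact Composition.ext (List.cons.inj this).2

lemma coeff_mul_b_le (m : ℕ) (i : Fin n) (α : FreeMonoid (Fin n)) :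
    f.coeff (FreeMonoid.of i) * f.b m α ≤ f.b m (FreeMonoid.of i * α) := by
  have h1 : f.coeff (FreeMonoid.of i) * f.b m α ≤
      ∑ c : Composition α.toList.length, f.bTerm m (i :: α.toList) (consOne c) := by
    unfold b
    rw [Finset.mul_sum]
    refine Finset.sum_le_sum fun c _ => ?_
    have hs : (i :: α.toList).splitWrtComposition (consOne c) =
        [i] :: α.toList.splitWrtComposition c := by
      change (i :: α.toList).splitWrtCompositionAux (1 :: c.blocks) = _
      simp [List.splitWrtComposition, List.splitWrtCompositionAux_cons]
    have hl : (consOne c).length = c.length + 1 := rfl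
    unfold bTerm
    rw [hs, hl, List.map_cons, List.prod_cons, mul_assoc]
    refine mul_le_mul_of_nonneg_left ?_ (f.coeff_nonneg _)
    refine mul_le_mul_of_nonneg_left ?_ (List.prod_nonneg ?_)
    · exact_mod_cast Nat.choose_le_choose _ (by omega)
    · intro x hx
      obtain ⟨γ, -, rfl⟩ := List.mem_map.1 hx
      exact f.coeff_nonneg _
  refine h1.trans ?_
  rw [← Finset.sum_map Finset.univ consOne (fun c => f.bTerm m (i :: α.toList) c)]
  exact Finset.sum_le_univ_sum_of_nonneg fun c => f.bTerm_nonneg m (i :: α.toList) c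

lemma b_one (m : ℕ) : f.b m 1 = 1 := by
  have : ∀ c : Composition ([] : List (Fin n)).length, f.bTerm m [] c = 1 := by
    intro c
    have hb : c.blocks = [] := by
      by_contra hne
      obtain ⟨x, hx⟩ := List.exists_mem_of_ne_nil _ hne
      have h1 := c.blocks_pos hx
      have h2 := List.le_sum_of_mem hx
      rw [c.blocks_sum] at h2
      simp at h2
      omega
    simp [bTerm, List.splitWrtComposition, List.splitWrtCompositionAux, Composition.length, hb]
  change ∑ c : Composition ([] : List (Fin n)).length, f.bTerm m [] c = 1
  rw [Finset.sum_congr rfl fun c _ => this c]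
  have hc : Fintype.card (Composition ([] : List (Fin n)).length) = 1 := by
    rw [composition_card]; simp
  simp only [Finset.sum_const, Finset.card_univ, hc, one_smul]

lemma b_pos (m : ℕ) (α : FreeMonoid (Fin n)) : 0 < f.b m α := by
  induction α using FreeMonoid.recOn with
  | one => rw [b_one]; exact one_pos
  | of_mul i α h =>
    exact lt_of_lt_of_le (mul_pos (f.coeff_of_pos i) h) (f.coeff_mul_b_le m i α)

end PosRegular

/-! ### The full Fock space and the weighted left creation operators -/

/-- The full Fock space `F²(Hₙ)`, written in its orthonormal basis `(e_α)` indexed by the words. -/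
abbrev Fock (n : ℕ) : Type := lp (fun _ : FreeMonoid (Fin n) => ℂ) 2

instance (n : ℕ) : DecidableEq (FreeMonoid (Fin n)) :=
  inferInstanceAs (DecidableEq (List (Fin n)))

/-- The vacuum vector `1 = e_{g₀}`. -/
def vacuum (n : ℕ) : Fock n := lp.single 2 1 1

namespace PosRegular

variable {n : ℕ} (f : PosRegular n)

/-- The weight `√(b_γ / b_{g_i γ})`. -/
def weight (m : ℕ) (i : Fin n) (γ : FreeMonoid (Fin n)) : ℝ :=
  √(f.b m γ / f.b m (FreeMonoid.of i * γ))

lemma weight_sq_le (m : ℕ) (i : Fin n) (γ : FreeMonoid (Fin n)) :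
    f.weight m i γ ^ 2 ≤ (f.coeff (FreeMonoid.of i))⁻¹ := by
  unfold weight
  rw [Real.sq_sqrt (div_nonneg (f.b_pos m _).le (f.b_pos m _).le),
    div_le_iff₀ (f.b_pos m _), inv_mul_eq_div, le_div_iff₀ (f.coeff_of_pos i), mul_comm]
  exact f.coeff_mul_b_le m i γ

/-- The coordinates of `W_i x`: `√(b_γ / b_{g_i γ}) x_γ` at the word `g_i γ`, and `0` at the words
that do not start with `g_i`. -/
def shiftFun (m : ℕ) (i : Fin n) (x : FreeMonoid (Fin n) → ℂ) : FreeMonoid (Fin n) → ℂ :=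
  Function.extend (fun γ => FreeMonoid.of i * γ) (fun γ => (f.weight m i γ : ℂ) * x γ) 0

lemma hasSum_shiftFun (m : ℕ) (i : Fin n) (x : Fock n) :
    ∃ s, HasSum (fun α => ‖f.shiftFun m i x α‖ ^ 2) s ∧
      s ≤ (f.coeff (FreeMonoid.of i))⁻¹ * ‖x‖ ^ 2 := by
  have hx : HasSum (fun γ => ‖x γ‖ ^ 2) (‖x‖ ^ 2) := by
    have := lp.hasSum_norm (p := 2) (by norm_num) x
    simpa using this
  have hle : ∀ γ, ‖(f.weight m i γ : ℂ) * x γ‖ ^ 2 ≤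
      (f.coeff (FreeMonoid.of i))⁻¹ * ‖x γ‖ ^ 2 := by
    intro γ
    rw [norm_mul, mul_pow, Complex.norm_real, Real.norm_eq_abs, sq_abs]
    exact mul_le_mul_of_nonneg_right (f.weight_sq_le m i γ) (sq_nonneg _)
  have hinj : Function.Injective (fun γ => FreeMonoid.of i * γ) := mul_right_injective _
  have hsum : Summable fun γ => ‖(f.weight m i γ : ℂ) * x γ‖ ^ 2 :=
    Summable.of_nonneg_of_le (fun _ => sq_nonneg _) hle (hx.summable.mul_left _)
  refine ⟨∑' γ, ‖(f.weight m i γ : ℂ) * x γ‖ ^ 2, ?_,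
    hasSum_le hle hsum.hasSum (hx.mul_left _)⟩
  rw [← Function.Injective.hasSum_iff hinj]
  · convert hsum.hasSum using 2 with γ
    simp [shiftFun, hinj.extend_apply]
  · intro α hα
    have : ¬∃ γ, FreeMonoid.of i * γ = α := fun ⟨γ, h⟩ => hα ⟨γ, h⟩
    simp [shiftFun, Function.extend_apply' _ _ _ this]

lemma memℓp_shiftFun (m : ℕ) (i : Fin n) (x : Fock n) :
    Memℓp (f.shiftFun m i x) 2 := by
  obtain ⟨s, hs, -⟩ := f.hasSum_shiftFun m i x
  refine memℓp_gen ?_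
  simpa using hs.summable

/-- The weighted left creation operator `W_i`, with
`W_i e_α = √(b_α^{(m)} / b_{g_i α}^{(m)}) e_{g_i α}`. -/
def W (m : ℕ) (i : Fin n) : Fock n →L[ℂ] Fock n :=
  LinearMap.mkContinuous
    { toFun := fun x => ⟨f.shiftFun m i x, f.memℓp_shiftFun m i x⟩
      map_add' := fun x y => by
        ext α
        change f.shiftFun m i (x + y : Fock n) α = f.shiftFun m i x α + f.shiftFun m i y α
        by_cases h : ∃ γ, FreeMonoid.of i * γ = α
        · obtain ⟨γ, rfl⟩ := h
          simp [shiftFun, (mul_right_injective (FreeMonoid.of i)).extend_apply, mul_add]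
        · simp [shiftFun, Function.extend_apply' _ _ _ h]
      map_smul' := fun c x => by
        ext α
        by_cases h : ∃ γ, FreeMonoid.of i * γ = α
        · obtain ⟨γ, rfl⟩ := h
          simp [shiftFun, (mul_right_injective (FreeMonoid.of i)).extend_apply, mul_left_comm]
        · simp [shiftFun, Function.extend_apply' _ _ _ h] }
    (√(f.coeff (FreeMonoid.of i))⁻¹) (fun x => by
      obtain ⟨s, hs, hle⟩ := f.hasSum_shiftFun m i x
      have h0 := inv_nonneg.2 (f.coeff_nonneg (FreeMonoid.of i))
      refine le_of_sq_le_sq ?_ (mul_nonneg (Real.sqrt_nonneg _) (norm_nonneg _))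
      rw [mul_pow, Real.sq_sqrt h0]
      refine le_trans (le_of_eq ?_) hle
      have h := lp.hasSum_norm (p := 2) (by norm_num)
        (⟨f.shiftFun m i x, f.memℓp_shiftFun m i x⟩ : Fock n)
      refine HasSum.unique ?_ hs
      simpa using h)

/-- `M_Q`: the closed span of the vectors `W_α q(W₁, …, Wₙ) W_β (1)`. -/
def MQ (m : ℕ) (Q : Set (FreeAlgebra ℂ (Fin n))) : Submodule ℂ (Fock n) :=
  (Submodule.span ℂ {v | ∃ q ∈ Q, ∃ α β : FreeMonoid (Fin n),
    v = monomial (f.W m) α (polyEval (f.W m) q (monomial (f.W m) β (vacuum n)))}).topologicalClosure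

/-- `N_Q = F²(Hₙ) ⊖ M_Q`. -/
def NQ (m : ℕ) (Q : Set (FreeAlgebra ℂ (Fin n))) : Submodule ℂ (Fock n) := (f.MQ m Q)ᗮ

instance (m : ℕ) (Q : Set (FreeAlgebra ℂ (Fin n))) : CompleteSpace (f.NQ m Q) :=
  inferInstanceAs (CompleteSpace ((f.MQ m Q)ᗮ : Submodule ℂ (Fock n)))

/-- The constrained weighted shift `B_i = P_{N_Q} W_i |_{N_Q}`. -/
def B (m : ℕ) (Q : Set (FreeAlgebra ℂ (Fin n))) (i : Fin n) : f.NQ m Q →L[ℂ] f.NQ m Q :=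
  (f.NQ m Q).orthogonalProjectionOnto ∘L f.W m i ∘L (f.NQ m Q).subtypeL

/-! ### The map `Φ_{f,X}`, noncommutative domains and varieties -/

section Domain

variable {H : Type*} [NormedAddCommGroup H] [InnerProductSpace ℂ H] [CompleteSpace H]

/-- The term `a_α X_α Y X_α^*` as an element of `B(H)` with the weak operator topology. -/
def PhiTerm (X : Fin n → H →L[ℂ] H) (Y : H →L[ℂ] H) (α : FreeMonoid (Fin n)) : H →WOT[ℂ] H :=
  .ofCLM ((f.coeff α : ℂ) • (monomial X α * Y * star (monomial X α)))

/-- `Φ_{f,X}(Y) = ∑_α a_α X_α Y X_α^*`, the sum being taken in the weak operator topology. (The empty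
word contributes nothing, its coefficient being `0`.) Where it is used, the sum converges for
`Y = I`, and hence for every `Y`. -/
def Phi (X : Fin n → H →L[ℂ] H) (Y : H →L[ℂ] H) : H →L[ℂ] H :=
  (∑' α, f.PhiTerm X Y α).toCLM

/-- `(id - Φ_{f,X})^k (I)`. -/
def defect (X : Fin n → H →L[ℂ] H) (k : ℕ) : H →L[ℂ] H :=
  (fun Y => Y - f.Phi X Y)^[k] 1

/-- The noncommutative domain `D_f^m(H)`. -/
def domain (m : ℕ) (H : Type*) [NormedAddCommGroup H] [InnerProductSpace ℂ H] [CompleteSpace H] :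
    Set (Fin n → H →L[ℂ] H) :=
  {X | Summable (f.PhiTerm X 1) ∧ ∀ k, 1 ≤ k → k ≤ m → 0 ≤ f.defect X k}

/-- The noncommutative variety `V_{f,Q}^m(H)`. -/
def variety (m : ℕ) (Q : Set (FreeAlgebra ℂ (Fin n)))
    (H : Type*) [NormedAddCommGroup H] [InnerProductSpace ℂ H] [CompleteSpace H] :
    Set (Fin n → H →L[ℂ] H) :=
  {X | X ∈ f.domain m H ∧ ∀ q ∈ Q, polyEval X q = 0}

/-- `X` is pure: `Φ_{f,X}^k(I) → 0` strongly as `k → ∞`. -/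
def IsPure (X : Fin n → H →L[ℂ] H) : Prop :=
  ∀ h : H, Tendsto (fun k : ℕ => ((f.Phi X)^[k] 1) h) atTop (𝓝 0)

/-- `Δ_{f,m,X} = [(id - Φ_{f,X})^m (I)]^{1/2}`. -/
def Delta (m : ℕ) (X : Fin n → H →L[ℂ] H) : H →L[ℂ] H := CFC.sqrt (f.defect X m)

/-- The closure of the range of `Δ_{f,m,X}`. -/
def defectSpace (m : ℕ) (X : Fin n → H →L[ℂ] H) : Submodule ℂ H :=
  (LinearMap.range (f.Delta m X : H →ₗ[ℂ] H)).topologicalClosure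

end Domain

end PosRegular

/-! ### Hilbert space tensor products and direct sums -/

/-- The Hilbert space tensor product. -/
abbrev HilbertTensor (E F : Type*) [NormedAddCommGroup E] [InnerProductSpace ℂ E]
    [NormedAddCommGroup F] [InnerProductSpace ℂ F] : Type _ :=
  UniformSpace.Completion (E ⊗[ℂ] F)

/-- The operator `A ⊗ I_F` on the Hilbert space tensor product. -/
def ampliation {E : Type*} (F : Type*) [NormedAddCommGroup E] [InnerProductSpace ℂ E]
    [NormedAddCommGroup F] [InnerProductSpace ℂ F] (A : E →L[ℂ] E) :
    HilbertTensor E F →L[ℂ] HilbertTensor E F :=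
  (A.rTensor F).completion

/-- The operator `A ⊕ U` on the Hilbert space direct sum `E ⊕ K`. -/
def directSum {E K : Type*} [NormedAddCommGroup E] [InnerProductSpace ℂ E]
    [NormedAddCommGroup K] [InnerProductSpace ℂ K] (A : E →L[ℂ] E) (U : K →L[ℂ] K) :
    WithLp 2 (E × K) →L[ℂ] WithLp 2 (E × K) :=
  ((WithLp.prodContinuousLinearEquiv 2 ℂ E K).symm : E × K →L[ℂ] WithLp 2 (E × K)) ∘L
    A.prodMap U ∘L (WithLp.prodContinuousLinearEquiv 2 ℂ E K : WithLp 2 (E × K) →L[ℂ] E × K)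

namespace PosRegular

variable {n : ℕ} (f : PosRegular n) {H : Type*} [NormedAddCommGroup H] [InnerProductSpace ℂ H]
  [CompleteSpace H]

/-- The space `(N_Q ⊗ closure (Δ_{f,m,T} H)) ⊕ K`. -/
abbrev DilationSpace (m : ℕ) (Q : Set (FreeAlgebra ℂ (Fin n))) (T : Fin n → H →L[ℂ] H)
    (K : Type*) [NormedAddCommGroup K] [InnerProductSpace ℂ K] : Type _ :=
  WithLp 2 (HilbertTensor (f.NQ m Q) (f.defectSpace m T) × K)

/-- The operators `V_i = (B_i ⊗ I) ⊕ U_i`. -/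
def dilation (m : ℕ) (Q : Set (FreeAlgebra ℂ (Fin n))) (T : Fin n → H →L[ℂ] H)
    {K : Type*} [NormedAddCommGroup K] [InnerProductSpace ℂ K] (U : Fin n → K →L[ℂ] K)
    (i : Fin n) : f.DilationSpace m Q T K →L[ℂ] f.DilationSpace m Q T K :=
  directSum (ampliation (f.defectSpace m T) (f.B m Q i)) (U i)

end PosRegular

end NCVariety

end

/-!
Let `S` be the weak limit of the decreasing powers `Φ_{f,T}^k(I)`. The series
`∑_k (k + m - 1).choose (m - 1) Φ^k ((id - Φ)^m (I))` telescopes to `I - S`, and regrouping its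
terms by words turns it into `∑_α b_α T_α Δ² T_α^*`. The Poisson kernel
`h ↦ ∑_α e_α ⊗ √b_α Δ T_α^* h` therefore maps `h` to a vector of squared norm `‖h‖² - ⟨h, S h⟩`. Its
adjoint intertwines `W_i ⊗ I` with `T_i`, so it kills `M_Q ⊗ D`, because `q(T) = 0` for `q ∈ Q`;
that is, the Poisson kernel takes its values in `N_Q ⊗ D`.

The missing part of the norm is `‖S^{1/2} h‖²`. Since `Φ_{f,T}(S) = S`, the operator `T_i^*` induces
`U_i^*` on the closure `K` of the range of `S^{1/2}`, with `Φ_{f,U}(I) = I`, and `K = {0}` exactly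
when `S = 0`.
-/

noncomputable section

namespace NCVariety

open ContinuousLinearMap (adjoint)
open scoped ComplexOrder

/-! ### Positive operators and weak operator limits -/

section WeakOperatorTopology

variable {ι : Type*} {H : Type*} [NormedAddCommGroup H] [InnerProductSpace ℂ H]

theorem nonneg_iff_inner_nonneg {A : H →L[ℂ] H} : 0 ≤ A ↔ ∀ h, 0 ≤ ⟪h, A h⟫_ℂ := by
  rw [ContinuousLinearMap.nonneg_iff_isPositive]
  refine ⟨fun hA h => hA.inner_nonneg_right h,
    fun hA => (ContinuousLinearMap.isPositive_iff_complex A).2 fun h => ?_⟩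
  have hconj : 0 ≤ ⟪A h, h⟫_ℂ := by
    rw [← inner_conj_symm, starRingEnd_apply, star_nonneg_iff]
    exact hA h
  exact ⟨Complex.ext rfl (Complex.nonneg_iff.1 hconj).2, (Complex.nonneg_iff.1 hconj).1⟩

theorem le_iff_inner_le {A B : H →L[ℂ] H} : A ≤ B ↔ ∀ h, ⟪h, A h⟫_ℂ ≤ ⟪h, B h⟫_ℂ := by
  rw [ContinuousLinearMap.le_def, ← ContinuousLinearMap.nonneg_iff_isPositive,
    nonneg_iff_inner_nonneg]
  simp only [sub_apply, inner_sub_right, sub_nonneg]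

theorem re_inner_nonneg {A : H →L[ℂ] H} (hA : 0 ≤ A) (h : H) : 0 ≤ (⟪h, A h⟫_ℂ).re :=
  (Complex.nonneg_iff.1 (nonneg_iff_inner_nonneg.1 hA h)).1

theorem coe_re_inner_self {A : H →L[ℂ] H} (hA : 0 ≤ A) (h : H) :
    ((⟪h, A h⟫_ℂ).re : ℂ) = ⟪h, A h⟫_ℂ :=
  Complex.ext rfl (Complex.nonneg_iff.1 (nonneg_iff_inner_nonneg.1 hA h)).2

theorem inner_polarization (A : H →L[ℂ] H) (g h : H) :
    ⟪g, A h⟫_ℂ = (⟪g + h, A (g + h)⟫_ℂ - ⟪g - h, A (g - h)⟫_ℂ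
      - Complex.I * ⟪g + Complex.I • h, A (g + Complex.I • h)⟫_ℂ
      + Complex.I * ⟪g - Complex.I • h, A (g - Complex.I • h)⟫_ℂ) / 4 := by
  simp only [map_add, map_sub, map_smul, inner_add_left, inner_add_right, inner_sub_left,
    inner_sub_right, inner_smul_left, inner_smul_right, Complex.conj_I]
  linear_combination ((1 / 2 : ℂ) * ⟪g, A h⟫_ℂ - (1 / 2) * ⟪h, A g⟫_ℂ) * Complex.I_mul_I

variable [CompleteSpace H]

theorem tendsto_wot_iff_inner_self {l : Filter ι} {A : ι → H →WOT[ℂ] H} {S : H →WOT[ℂ] H} :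
    Tendsto A l (𝓝 S) ↔ ∀ h, Tendsto (fun i => ⟪h, A i h⟫_ℂ) l (𝓝 ⟪h, S h⟫_ℂ) := by
  rw [ContinuousLinearMapWOT.tendsto_iff_forall_inner_apply_tendsto]
  refine ⟨fun hA h => hA h h, fun hA h g => ?_⟩
  simp only [← ContinuousLinearMapWOT.toCLM_apply, inner_polarization _ g h] at hA ⊢
  exact ((((hA _).sub (hA _)).sub ((hA _).const_mul _)).add ((hA _).const_mul _)).div_const _

theorem hasSum_wot_iff_inner_self {A : ι → H →WOT[ℂ] H} {S : H →WOT[ℂ] H} :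
    HasSum A S ↔ ∀ h, HasSum (fun i => ⟪h, A i h⟫_ℂ) ⟪h, S h⟫_ℂ := by
  have apply_sum (s : Finset ι) (h : H) : (∑ i ∈ s, A i) h = ∑ i ∈ s, A i h := by
    induction s using Finset.cons_induction with
    | empty => simp
    | cons i s _ ih => simp [Finset.sum_cons, ih]
  simp only [HasSum, tendsto_wot_iff_inner_self, apply_sum, inner_sum]

theorem exists_tendsto_wot_of_norm_le {l : Filter ι} [l.NeBot] {A : ι → H →L[ℂ] H} {C : ℝ}
    (hC : ∀ i, ‖A i‖ ≤ C) (hA : ∀ h, ∃ z, Tendsto (fun i => ⟪h, A i h⟫_ℂ) l (𝓝 z)) :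
    ∃ S : H →L[ℂ] H,
      Tendsto (fun i => ContinuousLinearMapWOT.ofCLM (A i)) l (𝓝 (.ofCLM S)) := by
  have exists_limit (g h : H) : ∃ z, Tendsto (fun i => ⟪g, A i h⟫_ℂ) l (𝓝 z) := by
    choose z hz using hA
    simp only [inner_polarization _ g h]
    exact ⟨_, ((((hz _).sub (hz _)).sub ((hz _).const_mul _)).add
      ((hz _).const_mul _)).div_const _⟩
  choose z hz using exists_limit
  have norm_limit_le (g h : H) : ‖z g h‖ ≤ C * ‖g‖ * ‖h‖ := by
    refine le_of_tendsto (hz g h).norm (Eventually.of_forall fun i => ?_)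
    calc ‖⟪g, A i h⟫_ℂ‖ ≤ ‖g‖ * (‖A i‖ * ‖h‖) :=
          (norm_inner_le_norm _ _).trans (by gcongr; exact (A i).le_opNorm h)
      _ ≤ ‖g‖ * (C * ‖h‖) := by gcongr; exact hC i
      _ = C * ‖g‖ * ‖h‖ := by ring
  let B : H →L⋆[ℂ] H →L[ℂ] ℂ := LinearMap.mkContinuous₂
    (LinearMap.mk₂'ₛₗ (starRingEnd ℂ) (RingHom.id ℂ) z
      (fun g g' h => tendsto_nhds_unique (hz _ _)
        (by simpa only [inner_add_left] using (hz g h).add (hz g' h)))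
      (fun c g h => tendsto_nhds_unique (hz _ _)
        (by simpa only [inner_smul_left, smul_eq_mul] using (hz g h).const_mul _))
      (fun g h h' => tendsto_nhds_unique (hz _ _)
        (by simpa only [map_add, inner_add_right] using (hz g h).add (hz g h')))
      (fun c g h => tendsto_nhds_unique (hz _ _)
        (by simpa only [map_smul, inner_smul_right, smul_eq_mul, RingHom.id_apply]
              using (hz g h).const_mul _))) C norm_limit_le
  refine ⟨adjoint (InnerProductSpace.continuousLinearMapOfBilin B),
    tendsto_wot_iff_inner_self.2 fun h => ?_⟩
  rw [ContinuousLinearMapWOT.ofCLM_apply, ContinuousLinearMap.adjoint_inner_right,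
    InnerProductSpace.continuousLinearMapOfBilin_apply]
  exact hz h h

theorem exists_tendsto_wot_of_monotone [Preorder ι] [IsDirectedOrder ι] [Nonempty ι]
    {A : ι → H →L[ℂ] H} {B : H →L[ℂ] H} (hmono : Monotone A) (h0 : ∀ i, 0 ≤ A i)
    (hB : ∀ i, A i ≤ B) :
    ∃ S : H →L[ℂ] H,
      Tendsto (fun i => ContinuousLinearMapWOT.ofCLM (A i)) atTop (𝓝 (.ofCLM S)) := by
  refine exists_tendsto_wot_of_norm_le (C := ‖B‖)
    (fun i => CStarAlgebra.norm_le_norm_of_nonneg_of_le (h0 i) (hB i)) fun h => ?_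
  have hsup := tendsto_atTop_ciSup (f := fun i => (⟪h, A i h⟫_ℂ).re)
    (fun i j hij => (Complex.le_def.1 (le_iff_inner_le.1 (hmono hij) h)).1)
    ⟨(⟪h, B h⟫_ℂ).re, Set.forall_mem_range.2 fun i =>
      (Complex.le_def.1 (le_iff_inner_le.1 (hB i) h)).1⟩
  exact ⟨_, ((Complex.continuous_ofReal.tendsto _).comp hsup).congr
    fun i => coe_re_inner_self (h0 i) h⟩

theorem summable_wot_of_sum_le {A : ι → H →L[ℂ] H} {B : H →L[ℂ] H} (h0 : ∀ i, 0 ≤ A i)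
    (hB : ∀ s : Finset ι, ∑ i ∈ s, A i ≤ B) :
    Summable fun i => ContinuousLinearMapWOT.ofCLM (A i) := by
  obtain ⟨S, hS⟩ := exists_tendsto_wot_of_monotone (A := fun s => ∑ i ∈ s, A i)
    (Finset.sum_mono_set_of_nonneg h0) (fun s => Finset.sum_nonneg fun i _ => h0 i) hB
  exact ⟨.ofCLM S, hS.congr fun s => map_sum ContinuousLinearMap.WOTofCLM A s⟩

theorem sum_le_of_hasSum_wot {A : ι → H →L[ℂ] H} {S : H →L[ℂ] H} (h0 : ∀ i, 0 ≤ A i)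
    (hS : HasSum (fun i => ContinuousLinearMapWOT.ofCLM (A i)) (.ofCLM S)) (s : Finset ι) :
    ∑ i ∈ s, A i ≤ S := by
  refine le_iff_inner_le.2 fun h => ?_
  rw [sum_apply, inner_sum]
  exact sum_le_hasSum s (fun i _ => nonneg_iff_inner_nonneg.1 (h0 i) h)
    (hasSum_wot_iff_inner_self.1 hS h)

end WeakOperatorTopology

/-! ### Monomials, intertwining operators and the map `Φ` -/

section Intertwining

variable {n : ℕ} {E F : Type*} [NormedAddCommGroup E] [InnerProductSpace ℂ E]
  [NormedAddCommGroup F] [InnerProductSpace ℂ F]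
  {X : Fin n → E →L[ℂ] E} {Z : Fin n → F →L[ℂ] F}

@[simp] theorem monomial_one (X : Fin n → E →L[ℂ] E) : monomial X 1 = 1 := map_one _

@[simp] theorem monomial_of (X : Fin n → E →L[ℂ] E) (i : Fin n) :
    monomial X (FreeMonoid.of i) = X i := FreeMonoid.lift_eval_of _ _

theorem monomial_mul (X : Fin n → E →L[ℂ] E) (α β : FreeMonoid (Fin n)) :
    monomial X (α * β) = monomial X α * monomial X β := map_mul _ _ _

theorem comp_monomial_eq {G : E →L[ℂ] F} (hG : ∀ i, G ∘L X i = Z i ∘L G)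
    (α : FreeMonoid (Fin n)) : G ∘L monomial X α = monomial Z α ∘L G := by
  induction α using FreeMonoid.recOn with
  | one => ext; simp
  | of_mul i α ih =>
    simp only [monomial_mul, monomial_of, ContinuousLinearMap.mul_def]
    rw [← ContinuousLinearMap.comp_assoc, hG, ContinuousLinearMap.comp_assoc, ih,
      ContinuousLinearMap.comp_assoc]

theorem comp_polyEval_eq {G : E →L[ℂ] F} (hG : ∀ i, G ∘L X i = Z i ∘L G)
    (q : FreeAlgebra ℂ (Fin n)) : G ∘L polyEval X q = polyEval Z q ∘L G := by
  unfold polyEval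
  induction q using FreeAlgebra.induction with
  | grade0 r => ext; simp [Algebra.algebraMap_eq_smul_one]
  | grade1 i => simpa using hG i
  | mul a b ha hb =>
    simp only [map_mul, ContinuousLinearMap.mul_def]
    rw [← ContinuousLinearMap.comp_assoc, ha, ContinuousLinearMap.comp_assoc, hb,
      ContinuousLinearMap.comp_assoc]
  | add a b ha hb => simp only [map_add, ContinuousLinearMap.comp_add, ha, hb,
      ContinuousLinearMap.add_comp]

end Intertwining

namespace PosRegular

variable {n : ℕ} (f : PosRegular n) {H : Type*} [NormedAddCommGroup H] [InnerProductSpace ℂ H]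
  [CompleteSpace H] {X : Fin n → H →L[ℂ] H} {Y Z : H →L[ℂ] H}

theorem inner_PhiTerm (X : Fin n → H →L[ℂ] H) (Y : H →L[ℂ] H) (α : FreeMonoid (Fin n)) (h : H) :
    ⟪h, f.PhiTerm X Y α h⟫_ℂ =
      f.coeff α * ⟪adjoint (monomial X α) h, Y (adjoint (monomial X α) h)⟫_ℂ := by
  rw [ContinuousLinearMap.adjoint_inner_left]
  simp [PhiTerm, ContinuousLinearMap.star_eq_adjoint]

theorem PhiTerm_sub (X : Fin n → H →L[ℂ] H) (Y Z : H →L[ℂ] H) :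
    f.PhiTerm X (Y - Z) = f.PhiTerm X Y - f.PhiTerm X Z := by
  ext1 α
  simp only [PhiTerm, mul_sub, sub_mul, smul_sub, ContinuousLinearMapWOT.ofCLM_sub, Pi.sub_apply]

theorem PhiTerm_add (X : Fin n → H →L[ℂ] H) (Y Z : H →L[ℂ] H) :
    f.PhiTerm X (Y + Z) = f.PhiTerm X Y + f.PhiTerm X Z := by
  ext1 α
  simp only [PhiTerm, mul_add, add_mul, smul_add, ContinuousLinearMapWOT.ofCLM_add, Pi.add_apply]

theorem PhiTerm_smul (X : Fin n → H →L[ℂ] H) (c : ℂ) (Y : H →L[ℂ] H) :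
    f.PhiTerm X (c • Y) = c • f.PhiTerm X Y := by
  ext1 α
  simp only [PhiTerm, mul_smul_comm, smul_mul_assoc, smul_comm _ c,
    ContinuousLinearMapWOT.ofCLM_smul, Pi.smul_apply]

theorem PhiTerm_nonneg (X : Fin n → H →L[ℂ] H) (hY : 0 ≤ Y) (α : FreeMonoid (Fin n)) :
    0 ≤ (f.PhiTerm X Y α).toCLM := by
  refine nonneg_iff_inner_nonneg.2 fun h => ?_
  rw [ContinuousLinearMapWOT.toCLM_apply, inner_PhiTerm]
  exact mul_nonneg (by exact_mod_cast f.coeff_nonneg α) (nonneg_iff_inner_nonneg.1 hY _)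

theorem PhiTerm_mono (X : Fin n → H →L[ℂ] H) (hYZ : Y ≤ Z) (α : FreeMonoid (Fin n)) :
    (f.PhiTerm X Y α).toCLM ≤ (f.PhiTerm X Z α).toCLM := by
  rw [← sub_nonneg, ← ContinuousLinearMapWOT.toCLM_sub, ← Pi.sub_apply, ← PhiTerm_sub]
  exact f.PhiTerm_nonneg X (sub_nonneg.2 hYZ) α

theorem summable_PhiTerm_of_le (hY : 0 ≤ Y) (hYZ : Y ≤ Z) (hZ : Summable (f.PhiTerm X Z)) :
    Summable (f.PhiTerm X Y) :=
  summable_wot_of_sum_le (f.PhiTerm_nonneg X hY) fun s =>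
    (Finset.sum_le_sum fun α _ => f.PhiTerm_mono X hYZ α).trans
      (sum_le_of_hasSum_wot (f.PhiTerm_nonneg X (hY.trans hYZ)) hZ.hasSum s)

theorem summable_PhiTerm (hX : Summable (f.PhiTerm X 1)) (Y : H →L[ℂ] H) :
    Summable (f.PhiTerm X Y) := by
  have hY : Y ∈ Submodule.span ℂ {A : H →L[ℂ] H | 0 ≤ A} := by
    rw [CStarAlgebra.span_nonneg]
    exact Submodule.mem_top
  induction hY using Submodule.span_induction with
  | mem A hA =>
    refine f.summable_PhiTerm_of_le hA (Z := (‖A‖ : ℂ) • 1) ?_ ?_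
    · exact (IsSelfAdjoint.of_nonneg hA).le_algebraMap_norm_self
    · exact f.PhiTerm_smul X _ 1 ▸ hX.const_smul (‖A‖ : ℂ)
  | zero => exact zero_smul ℂ (1 : H →L[ℂ] H) ▸ f.PhiTerm_smul X 0 1 ▸ hX.const_smul (0 : ℂ)
  | add A B _ _ hA hB => exact f.PhiTerm_add X A B ▸ hA.add hB
  | smul c A _ hA => exact f.PhiTerm_smul X c A ▸ hA.const_smul c

theorem hasSum_PhiTerm (hX : Summable (f.PhiTerm X 1)) (Y : H →L[ℂ] H) :
    HasSum (f.PhiTerm X Y) (.ofCLM (f.Phi X Y)) :=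
  (f.summable_PhiTerm hX Y).hasSum

theorem hasSum_inner_Phi (hX : Summable (f.PhiTerm X 1)) (Y : H →L[ℂ] H) (h : H) :
    HasSum (fun α => (f.coeff α : ℂ) *
      ⟪adjoint (monomial X α) h, Y (adjoint (monomial X α) h)⟫_ℂ) ⟪h, f.Phi X Y h⟫_ℂ := by
  simpa only [inner_PhiTerm, ContinuousLinearMapWOT.ofCLM_apply]
    using hasSum_wot_iff_inner_self.1 (f.hasSum_PhiTerm hX Y) h

theorem Phi_sub (hX : Summable (f.PhiTerm X 1)) (Y Z : H →L[ℂ] H) :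
    f.Phi X (Y - Z) = f.Phi X Y - f.Phi X Z := by
  rw [Phi, PhiTerm_sub, Phi, Phi, ← ContinuousLinearMapWOT.toCLM_sub]
  exact congrArg _ ((f.summable_PhiTerm hX Y).tsum_sub (f.summable_PhiTerm hX Z))

theorem sum_PhiTerm_le_Phi (hX : Summable (f.PhiTerm X 1)) (hY : 0 ≤ Y)
    (s : Finset (FreeMonoid (Fin n))) : ∑ α ∈ s, (f.PhiTerm X Y α).toCLM ≤ f.Phi X Y :=
  sum_le_of_hasSum_wot (f.PhiTerm_nonneg X hY) (f.hasSum_PhiTerm hX Y) s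

theorem Phi_nonneg (hX : Summable (f.PhiTerm X 1)) (hY : 0 ≤ Y) : 0 ≤ f.Phi X Y := by
  simpa using f.sum_PhiTerm_le_Phi hX hY ∅

theorem Phi_mono (hX : Summable (f.PhiTerm X 1)) : Monotone (f.Phi X) := fun Y Z hYZ => by
  rw [← sub_nonneg, ← f.Phi_sub hX]
  exact f.Phi_nonneg hX (sub_nonneg.2 hYZ)

theorem Phi_iterate_nonneg (hX : Summable (f.PhiTerm X 1)) (hY : 0 ≤ Y) (k : ℕ) :
    0 ≤ (f.Phi X)^[k] Y :=
  Function.Iterate.rec (fun A => 0 ≤ A) hY (fun _ => f.Phi_nonneg hX) k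

theorem Phi_iterate_sub (hX : Summable (f.PhiTerm X 1)) (Y Z : H →L[ℂ] H) (k : ℕ) :
    (f.Phi X)^[k] (Y - Z) = (f.Phi X)^[k] Y - (f.Phi X)^[k] Z :=
  Function.Semiconj₂.iterate (f.Phi_sub hX) k Y Z

theorem Phi_iterate_defect_succ (hX : Summable (f.PhiTerm X 1)) (j k : ℕ) :
    (f.Phi X)^[k] (f.defect X (j + 1)) =
      (f.Phi X)^[k] (f.defect X j) - (f.Phi X)^[k + 1] (f.defect X j) := by
  rw [defect, Function.iterate_succ_apply', ← defect, f.Phi_iterate_sub hX,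
    Function.iterate_succ_apply]

theorem tendsto_Phi {ι : Type*} {l : Filter ι} [l.IsCountablyGenerated]
    (hX : Summable (f.PhiTerm X 1)) {A : ι → H →L[ℂ] H}
    {S : H →L[ℂ] H} {C : ℝ} (hC : ∀ i, ‖A i‖ ≤ C)
    (hA : Tendsto (fun i => ContinuousLinearMapWOT.ofCLM (A i)) l (𝓝 (.ofCLM S))) :
    Tendsto (fun i => ContinuousLinearMapWOT.ofCLM (f.Phi X (A i))) l
      (𝓝 (.ofCLM (f.Phi X S))) := by
  refine tendsto_wot_iff_inner_self.2 fun h => ?_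
  simp only [ContinuousLinearMapWOT.ofCLM_apply, ← fun Y => (f.hasSum_inner_Phi hX Y h).tsum_eq]
  have hbound : Summable fun α => C * ‖(f.coeff α : ℂ) *
      ⟪adjoint (monomial X α) h, (1 : H →L[ℂ] H) (adjoint (monomial X α) h)⟫_ℂ‖ :=
    (f.hasSum_inner_Phi hX 1 h).summable.norm.mul_left C
  refine tendsto_tsum_of_dominated_convergence hbound
    (fun α => (tendsto_wot_iff_inner_self.1 hA _).const_mul _)
    (Eventually.of_forall fun i α => ?_)
  rw [norm_mul, norm_mul, mul_left_comm, one_apply_eq_self, inner_self_eq_norm_sq_to_K]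
  gcongr
  set x := adjoint (monomial X α) h
  calc ‖⟪x, A i x⟫_ℂ‖ ≤ ‖x‖ * (‖A i‖ * ‖x‖) :=
        (norm_inner_le_norm _ _).trans (by gcongr; exact (A i).le_opNorm x)
    _ ≤ ‖x‖ * (C * ‖x‖) := by gcongr; exact hC i
    _ = C * ‖(‖x‖ : ℂ) ^ 2‖ := by rw [norm_pow, Complex.norm_real, norm_norm]; ring

end PosRegular

/-! ### The telescoping series for the coefficients `b_α` -/

section Telescoping

open Finset.HasAntidiagonal (antidiagonal mem_antidiagonal)

theorem tsum_ofReal_telescope {x y : ℕ → ℝ} (hdiff : ∀ k, y k = x k - x (k + 1))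
    (hy : ∀ k, 0 ≤ y k) {L : ℝ} (hL : Tendsto x atTop (𝓝 L)) (k : ℕ) :
    ∑' i, ENNReal.ofReal (y (k + i)) = ENNReal.ofReal (x k - L) := by
  have hsum : HasSum (fun i => y (k + i)) (x k - L) := by
    rw [hasSum_iff_tendsto_nat_of_nonneg fun i => hy _]
    have partial_sum (N : ℕ) : ∑ i ∈ Finset.range N, y (k + i) = x k - x (k + N) := by
      simpa only [hdiff, add_zero, add_assoc] using Finset.sum_range_sub' (fun i => x (k + i)) N
    simp only [partial_sum]
    exact tendsto_const_nhds.sub (hL.comp (tendsto_atTop_mono (Nat.le_add_left · k) tendsto_id))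
  rw [← hsum.tsum_eq, ENNReal.ofReal_tsum_of_nonneg (fun i => hy _) hsum.summable]

theorem tsum_tsum_choose_mul_add (p : ℕ) (z : ℕ → ENNReal) :
    ∑' k, ∑' i, ((k + p).choose p : ENNReal) * z (k + i) =
      ∑' s, ((s + p + 1).choose (p + 1) : ENNReal) * z s := by
  rw [← ENNReal.tsum_prod (f := fun k i => ((k + p).choose p : ENNReal) * z (k + i)),
    ← Finset.HasAntidiagonal.sigmaAntidiagonalEquivProd.tsum_eq, ENNReal.tsum_sigma']
  refine tsum_congr fun s => ?_
  calc ∑' q : antidiagonal s, ((q.1.1 + p).choose p : ENNReal) * z (q.1.1 + q.1.2)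
    _ = ∑ q ∈ antidiagonal s, ((q.1 + p).choose p : ENNReal) * z (q.1 + q.2) := by
        rw [Finset.tsum_subtype (antidiagonal s)
          fun q : ℕ × ℕ => ((q.1 + p).choose p : ENNReal) * z (q.1 + q.2)]
    _ = ∑ q ∈ antidiagonal s, ((q.1 + p).choose p : ENNReal) * z s :=
        Finset.sum_congr rfl fun q hq => by rw [mem_antidiagonal.1 hq]
    _ = ((s + p + 1).choose (p + 1) : ENNReal) * z s := by
        rw [← Finset.sum_mul, Finset.Nat.sum_antidiagonal_eq_sum_range_succ_mk,
          ← Nat.sum_range_add_choose]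
        push_cast
        rfl

theorem tsum_choose_mul_diff (p : ℕ) (x : ℕ → ℕ → ℝ)
    (hdiff : ∀ j k, x (j + 1) k = x j k - x j (k + 1))
    (hpos : ∀ j ≤ p + 1, ∀ k, 0 ≤ x j k) {L : ℝ} (hL : Tendsto (x 0) atTop (𝓝 L)) :
    ∑' k, ((k + p).choose p : ENNReal) * ENNReal.ofReal (x (p + 1) k) =
      ENNReal.ofReal (x 0 0 - L) := by
  induction p with
  | zero => simpa using tsum_ofReal_telescope (hdiff 0) (hpos 1 le_rfl) hL 0
  | succ p ih =>
    have tendsto_diff {j : ℕ} {l : ℝ} (hj : Tendsto (x j) atTop (𝓝 l)) :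
        Tendsto (x (j + 1)) atTop (𝓝 0) := by
      simpa [funext (hdiff j)] using hj.sub ((tendsto_add_atTop_iff_nat 1).2 hj)
    have tendsto_zero (j : ℕ) : Tendsto (x (j + 1)) atTop (𝓝 0) := by
      induction j with
      | zero => exact tendsto_diff hL
      | succ j ih => exact tendsto_diff ih
    have tail_sum (k : ℕ) :
        ENNReal.ofReal (x (p + 1) k) = ∑' i, ENNReal.ofReal (x (p + 2) (k + i)) := by
      rw [tsum_ofReal_telescope (hdiff (p + 1)) (hpos (p + 2) le_rfl) (tendsto_zero p) k, sub_zero]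
    rw [← ih fun j hj => hpos j (by omega)]
    simp only [tail_sum, ← ENNReal.tsum_mul_left]
    exact (tsum_tsum_choose_mul_add p fun s => ENNReal.ofReal (x (p + 2) s)).symm

end Telescoping

section Factorizations

theorem tsum_tsum_ofFn_eq_tsum_tsum_prod {M : Type*} [Monoid M] (φ : List M → ENNReal) :
    ∑' k, ∑' v : Fin k → M, φ (List.ofFn v) = ∑' a : M, ∑' L : {L : List M // L.prod = a}, φ L := by
  calc ∑' k, ∑' v : Fin k → M, φ (List.ofFn v)
    _ = ∑' L, φ L := by
        rw [← ENNReal.tsum_sigma fun k (v : Fin k → M) => φ (List.ofFn v)]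
        exact List.equivSigmaTuple.symm.tsum_eq φ
    _ = ∑' a : M, ∑' L : {L : List M // L.prod = a}, φ L := by
        rw [← (Equiv.sigmaFiberEquiv (List.prod : List M → M)).tsum_eq, ENNReal.tsum_sigma']
        rfl

variable {ι : Type*}

/-- The factorization `γ₁ ⋯ γ_j = α` of a word that cuts it into blocks of the lengths prescribed
by a composition of `|α|`. -/
def blockFactorization (α : FreeMonoid ι) (c : Composition α.toList.length) :
    {L : List (FreeMonoid ι) // L.prod = α} :=
  ⟨(α.toList.splitWrtComposition c).map FreeMonoid.ofList, FreeMonoid.toList.injective <| by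
    rw [FreeMonoid.toList_prod, List.map_map]
    simp⟩

theorem blockFactorization_injective (α : FreeMonoid ι) :
    Function.Injective (blockFactorization α) := by
  intro c d hcd
  have hsplit : α.toList.splitWrtComposition c = α.toList.splitWrtComposition d :=
    List.map_injective_iff.2 FreeMonoid.ofList.injective (congrArg Subtype.val hcd)
  have hblocks := congrArg (List.map List.length) hsplit
  rw [List.map_length_splitWrtComposition, List.map_length_splitWrtComposition] at hblocks
  exact Composition.ext hblocks

theorem mem_range_blockFactorization {α : FreeMonoid ι}
    {L : {L : List (FreeMonoid ι) // L.prod = α}} (hL : 1 ∉ L.1) :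
    L ∈ Set.range (blockFactorization α) := by
  obtain ⟨L, rfl⟩ := L
  let c : Composition L.prod.toList.length :=
    { blocks := (L.map FreeMonoid.toList).map List.length
      blocks_pos := by
        simp only [List.map_map, List.mem_map]
        rintro _ ⟨γ, hγ, rfl⟩
        exact List.length_pos_iff.2 fun h => hL ((FreeMonoid.toList.injective h : γ = 1) ▸ hγ)
      blocks_sum := by rw [FreeMonoid.toList_prod, List.length_flatten] }
  have hsplit : L.prod.toList.splitWrtComposition c = L.map FreeMonoid.toList := by
    rw [List.eq_iff_flatten_eq, List.flatten_splitWrtComposition,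
      List.map_length_splitWrtComposition]
    exact ⟨FreeMonoid.toList_prod L, rfl⟩
  refine ⟨c, Subtype.ext ?_⟩
  change (L.prod.toList.splitWrtComposition c).map FreeMonoid.ofList = L
  rw [hsplit]
  simp

end Factorizations

namespace PosRegular

variable {n : ℕ} (f : PosRegular n)

/-- The product `a_{γ₁} ⋯ a_{γ_j}` for a list of words, valued in `[0, ∞]` so that sums over lists
can be regrouped freely. -/
def listCoeff (L : List (FreeMonoid (Fin n))) : ENNReal :=
  (L.map fun γ => ENNReal.ofReal (f.coeff γ)).prod

theorem listCoeff_eq_zero_of_one_mem {L : List (FreeMonoid (Fin n))} (hL : 1 ∈ L) :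
    f.listCoeff L = 0 :=
  List.prod_eq_zero (List.mem_map.2 ⟨1, hL, by rw [f.coeff_one, ENNReal.ofReal_zero]⟩)

theorem ofReal_prod_coeff (L : List (FreeMonoid (Fin n))) :
    ENNReal.ofReal (L.map f.coeff).prod = f.listCoeff L := by
  induction L with
  | nil => simp [listCoeff]
  | cons γ L ih =>
    rw [List.map_cons, List.prod_cons, ENNReal.ofReal_mul (f.coeff_nonneg γ), ih, listCoeff,
      listCoeff, List.map_cons, List.prod_cons]

theorem ofReal_bTerm (m : ℕ) (α : FreeMonoid (Fin n)) (c : Composition α.toList.length) :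
    ENNReal.ofReal (f.bTerm m α.toList c) =
      f.listCoeff (blockFactorization α c) * ((c.length + m - 1).choose (m - 1) : ENNReal) := by
  rw [bTerm, ENNReal.ofReal_mul' (Nat.cast_nonneg _), ENNReal.ofReal_natCast, ← ofReal_prod_coeff,
    blockFactorization, List.map_map]
  rfl

theorem tsum_listCoeff_mul_choose (m : ℕ) (α : FreeMonoid (Fin n)) :
    ∑' L : {L : List (FreeMonoid (Fin n)) // L.prod = α},
      f.listCoeff L * ((L.1.length + m - 1).choose (m - 1) : ENNReal) =
        ENNReal.ofReal (f.b m α) := by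
  rw [← (blockFactorization_injective α).tsum_eq, tsum_fintype, b,
    ENNReal.ofReal_sum_of_nonneg fun c _ => f.bTerm_nonneg m _ c]
  · refine Finset.sum_congr rfl fun c _ => ?_
    rw [ofReal_bTerm]
    simp [blockFactorization]
  · intro L hL
    exact mem_range_blockFactorization fun h1 =>
      hL (mul_eq_zero_of_left (f.listCoeff_eq_zero_of_one_mem h1) _)

end PosRegular

/-- The quadratic form `⟨h, Y h⟩` of a positive operator `Y`, valued in `[0, ∞]`. -/
def ennrealForm {H : Type*} [NormedAddCommGroup H] [InnerProductSpace ℂ H] (Y : H →L[ℂ] H)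
    (h : H) : ENNReal :=
  ENNReal.ofReal (⟪h, Y h⟫_ℂ).re

namespace PosRegular

variable {n : ℕ} (f : PosRegular n) {H : Type*} [NormedAddCommGroup H] [InnerProductSpace ℂ H]
  [CompleteSpace H] {X : Fin n → H →L[ℂ] H} {Y : H →L[ℂ] H}

theorem ennrealForm_Phi (hX : Summable (f.PhiTerm X 1)) (hY : 0 ≤ Y) (h : H) :
    ennrealForm (f.Phi X Y) h =
      ∑' α, ENNReal.ofReal (f.coeff α) * ennrealForm Y (adjoint (monomial X α) h) := by
  have hsum := Complex.hasSum_re (f.hasSum_inner_Phi hX Y h)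
  simp only [Complex.re_ofReal_mul] at hsum
  rw [ennrealForm, ← hsum.tsum_eq, ENNReal.ofReal_tsum_of_nonneg
    (fun α => mul_nonneg (f.coeff_nonneg α) (re_inner_nonneg hY _)) hsum.summable]
  exact tsum_congr fun α => ENNReal.ofReal_mul (f.coeff_nonneg α)

theorem ennrealForm_Phi_iterate (hX : Summable (f.PhiTerm X 1)) (hY : 0 ≤ Y) (k : ℕ) (h : H) :
    ennrealForm ((f.Phi X)^[k] Y) h =
      ∑' v : Fin k → FreeMonoid (Fin n), f.listCoeff (List.ofFn v) *
        ennrealForm Y (adjoint (monomial X (List.ofFn v).prod) h) := by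
  induction k generalizing h with
  | zero => simp [listCoeff, ← ContinuousLinearMap.star_eq_adjoint]
  | succ k ih =>
    rw [Function.iterate_succ_apply', f.ennrealForm_Phi hX (f.Phi_iterate_nonneg hX hY k),
      ← (Fin.consEquiv fun _ => FreeMonoid (Fin n)).tsum_eq, ENNReal.tsum_prod']
    refine tsum_congr fun α => ?_
    rw [ih, ← ENNReal.tsum_mul_left]
    refine tsum_congr fun v => ?_
    have hcons : List.ofFn (Fin.consEquiv (fun _ => FreeMonoid (Fin n)) (α, v)) =
        α :: List.ofFn v := List.ofFn_cons α v
    rw [hcons, List.prod_cons, monomial_mul, ← ContinuousLinearMap.star_eq_adjoint (_ * _),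
      star_mul, listCoeff, listCoeff, List.map_cons, List.prod_cons, mul_assoc]
    rfl

theorem tsum_b_mul_ennrealForm (hX : Summable (f.PhiTerm X 1)) (hY : 0 ≤ Y) (m : ℕ) (h : H) :
    ∑' α, ENNReal.ofReal (f.b m α) * ennrealForm Y (adjoint (monomial X α) h) =
      ∑' k, ((k + m - 1).choose (m - 1) : ENNReal) * ennrealForm ((f.Phi X)^[k] Y) h := by
  let φ (L : List (FreeMonoid (Fin n))) : ENNReal :=
    f.listCoeff L * ((L.length + m - 1).choose (m - 1) : ENNReal) *
      ennrealForm Y (adjoint (monomial X L.prod) h)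
  calc ∑' α, ENNReal.ofReal (f.b m α) * ennrealForm Y (adjoint (monomial X α) h)
    _ = ∑' α, ∑' L : {L : List (FreeMonoid (Fin n)) // L.prod = α}, φ L := by
        refine tsum_congr fun α => ?_
        rw [← tsum_listCoeff_mul_choose, ← ENNReal.tsum_mul_right]
        exact tsum_congr fun L => by simp only [φ, L.2]
    _ = ∑' k, ∑' v : Fin k → FreeMonoid (Fin n), φ (List.ofFn v) :=
        (tsum_tsum_ofFn_eq_tsum_tsum_prod φ).symm
    _ = ∑' k, ((k + m - 1).choose (m - 1) : ENNReal) * ennrealForm ((f.Phi X)^[k] Y) h := by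
        refine tsum_congr fun k => ?_
        rw [f.ennrealForm_Phi_iterate hX hY, ← ENNReal.tsum_mul_left]
        refine tsum_congr fun v => ?_
        simp only [φ, List.length_ofFn]
        ring

theorem defect_nonneg {m : ℕ} (hX : X ∈ f.domain m H) {k : ℕ} (hk : k ≤ m) : 0 ≤ f.defect X k := by
  rcases Nat.eq_zero_or_pos k with rfl | hk0
  · exact zero_le_one
  · exact hX.2 k hk0 hk

theorem tsum_b_mul_ennrealForm_defect {m : ℕ} (hm : 1 ≤ m) (hX : X ∈ f.domain m H) (h : H) {l : ℝ}
    (hl : Tendsto (fun k => (⟪h, (f.Phi X)^[k] 1 h⟫_ℂ).re) atTop (𝓝 l)) :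
    ∑' α, ENNReal.ofReal (f.b m α) * ennrealForm (f.defect X m) (adjoint (monomial X α) h) =
      ENNReal.ofReal (‖h‖ ^ 2 - l) := by
  obtain ⟨p, rfl⟩ := Nat.exists_eq_add_of_le' hm
  have htelescope := tsum_choose_mul_diff p
    (fun j k => (⟪h, (f.Phi X)^[k] (f.defect X j) h⟫_ℂ).re)
    (fun j k => by simp [f.Phi_iterate_defect_succ hX.1])
    (fun j hj k => re_inner_nonneg (f.Phi_iterate_nonneg hX.1 (f.defect_nonneg hX hj) k) h) hl
  have hnorm : (⟪h, (f.Phi X)^[0] (f.defect X 0) h⟫_ℂ).re = ‖h‖ ^ 2 := by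
    simp [defect, ← Complex.ofReal_pow]
  rw [f.tsum_b_mul_ennrealForm hX.1 (f.defect_nonneg hX le_rfl), ← hnorm]
  exact htelescope

end PosRegular

/-! ### The limit of `Φ^k(I)` -/

section PositiveOperators

variable {H : Type*} [NormedAddCommGroup H] [InnerProductSpace ℂ H] [CompleteSpace H]
  {A : H →L[ℂ] H}

theorem norm_sqrt_apply_sq (hA : 0 ≤ A) (h : H) : ‖CFC.sqrt A h‖ ^ 2 = (⟪h, A h⟫_ℂ).re := by
  rw [ContinuousLinearMap.apply_norm_sq_eq_inner_adjoint_right,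
    (IsSelfAdjoint.of_nonneg (CFC.sqrt_nonneg A)).adjoint_eq, ← ContinuousLinearMap.mul_def,
    CFC.sqrt_mul_sqrt_self A hA]
  rfl

theorem norm_apply_sq_le (hA : 0 ≤ A) (hA1 : A ≤ 1) (h : H) : ‖A h‖ ^ 2 ≤ (⟪h, A h⟫_ℂ).re := by
  have sq_le : A ^ 2 ≤ A := by simpa using CStarAlgebra.pow_antitone hA hA1 one_le_two
  rw [ContinuousLinearMap.apply_norm_sq_eq_inner_adjoint_right,
    (IsSelfAdjoint.of_nonneg hA).adjoint_eq, ← ContinuousLinearMap.mul_def, ← sq]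
  exact (Complex.le_def.1 (le_iff_inner_le.1 sq_le h)).1

theorem le_of_tendsto_wot {ι : Type*} {l : Filter ι} [l.NeBot] {A B : ι → H →L[ℂ] H}
    {S R : H →L[ℂ] H} (hA : Tendsto (fun i => ContinuousLinearMapWOT.ofCLM (A i)) l (𝓝 (.ofCLM S)))
    (hB : Tendsto (fun i => ContinuousLinearMapWOT.ofCLM (B i)) l (𝓝 (.ofCLM R)))
    (hAB : ∀ i, A i ≤ B i) : S ≤ R :=
  le_iff_inner_le.2 fun h => le_of_tendsto_of_tendsto' (tendsto_wot_iff_inner_self.1 hA h)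
    (tendsto_wot_iff_inner_self.1 hB h) fun i => le_iff_inner_le.1 (hAB i) h

end PositiveOperators

namespace PosRegular

variable {n : ℕ} (f : PosRegular n) {H : Type*} [NormedAddCommGroup H] [InnerProductSpace ℂ H]
  [CompleteSpace H] {X : Fin n → H →L[ℂ] H} {m : ℕ}

/-- The weak limit of the powers `Φ_{f,X}^k(I)`, the obstruction to `X` being pure. It is
meaningful when `Φ_{f,X}(I) ≤ I`; the powers then decrease. -/
def asymptoticLimit (X : Fin n → H →L[ℂ] H) : H →L[ℂ] H :=
  (limUnder atTop fun k : ℕ => ContinuousLinearMapWOT.ofCLM ((f.Phi X)^[k] 1)).toCLM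

theorem Phi_one_le_one (hm : 1 ≤ m) (hX : X ∈ f.domain m H) : f.Phi X 1 ≤ 1 :=
  sub_nonneg.1 (hX.2 1 le_rfl hm)

theorem Phi_iterate_one_antitone (hX : Summable (f.PhiTerm X 1)) (h1 : f.Phi X 1 ≤ 1) :
    Antitone fun k => (f.Phi X)^[k] 1 :=
  (f.Phi_mono hX).antitone_iterate_of_map_le h1

theorem tendsto_asymptoticLimit (hX : Summable (f.PhiTerm X 1)) (h1 : f.Phi X 1 ≤ 1) :
    Tendsto (fun k : ℕ => ContinuousLinearMapWOT.ofCLM ((f.Phi X)^[k] 1)) atTop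
      (𝓝 (.ofCLM (f.asymptoticLimit X))) := by
  refine tendsto_nhds_limUnder ?_
  obtain ⟨S, hS⟩ := exists_tendsto_wot_of_monotone (A := fun k => 1 - (f.Phi X)^[k] 1) (B := 1)
    (fun j k hjk => sub_le_sub_left (f.Phi_iterate_one_antitone hX h1 hjk) 1)
    (fun k => sub_nonneg.2 (f.Phi_iterate_one_antitone hX h1 k.zero_le))
    (fun k => sub_le_self 1 (f.Phi_iterate_nonneg hX zero_le_one k))
  refine ⟨.ofCLM (1 - S), ?_⟩
  simpa only [← ContinuousLinearMapWOT.ofCLM_sub, sub_sub_cancel]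
    using hS.const_sub (ContinuousLinearMapWOT.ofCLM 1)

theorem asymptoticLimit_nonneg (hX : Summable (f.PhiTerm X 1)) (h1 : f.Phi X 1 ≤ 1) :
    0 ≤ f.asymptoticLimit X :=
  le_of_tendsto_wot tendsto_const_nhds (f.tendsto_asymptoticLimit hX h1)
    fun k => f.Phi_iterate_nonneg hX zero_le_one k

theorem asymptoticLimit_le_one (hX : Summable (f.PhiTerm X 1)) (h1 : f.Phi X 1 ≤ 1) :
    f.asymptoticLimit X ≤ 1 :=
  le_of_tendsto_wot (f.tendsto_asymptoticLimit hX h1) tendsto_const_nhds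
    fun k => f.Phi_iterate_one_antitone hX h1 k.zero_le

theorem Phi_asymptoticLimit (hX : Summable (f.PhiTerm X 1)) (h1 : f.Phi X 1 ≤ 1) :
    f.Phi X (f.asymptoticLimit X) = f.asymptoticLimit X := by
  have norm_le (k : ℕ) : ‖(f.Phi X)^[k] 1‖ ≤ 1 :=
    (CStarAlgebra.norm_le_one_iff_of_nonneg _ (f.Phi_iterate_nonneg hX zero_le_one k)).2
      (f.Phi_iterate_one_antitone hX h1 k.zero_le)
  have hlim := f.tendsto_asymptoticLimit hX h1
  have hshift := (tendsto_add_atTop_iff_nat 1).2 hlim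
  simp only [Function.iterate_succ_apply'] at hshift
  exact congrArg _ (tendsto_nhds_unique (f.tendsto_Phi hX norm_le hlim) hshift)

theorem tendsto_re_inner_Phi_iterate (hX : Summable (f.PhiTerm X 1)) (h1 : f.Phi X 1 ≤ 1) (h : H) :
    Tendsto (fun k => (⟪h, (f.Phi X)^[k] 1 h⟫_ℂ).re) atTop
      (𝓝 (⟪h, f.asymptoticLimit X h⟫_ℂ).re) :=
  (Complex.continuous_re.tendsto _).comp
    (tendsto_wot_iff_inner_self.1 (f.tendsto_asymptoticLimit hX h1) h)

theorem asymptoticLimit_eq_zero_iff_isPure (hX : Summable (f.PhiTerm X 1)) (h1 : f.Phi X 1 ≤ 1) :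
    f.asymptoticLimit X = 0 ↔ f.IsPure X := by
  refine ⟨fun hS h => ?_, fun hpure => ?_⟩
  · have form_tendsto := f.tendsto_re_inner_Phi_iterate hX h1 h
    rw [hS, zero_apply, inner_zero_right, Complex.zero_re] at form_tendsto
    refine tendsto_zero_iff_norm_tendsto_zero.2 (squeeze_zero (fun _ => norm_nonneg _)
      (fun k => Real.le_sqrt_of_sq_le ?_) (by simpa using form_tendsto.sqrt))
    exact norm_apply_sq_le (f.Phi_iterate_nonneg hX zero_le_one k)
      (f.Phi_iterate_one_antitone hX h1 k.zero_le) h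
  · have hzero : Tendsto (fun k : ℕ => ContinuousLinearMapWOT.ofCLM ((f.Phi X)^[k] 1)) atTop
        (𝓝 (.ofCLM 0)) := tendsto_wot_iff_inner_self.2 fun h => by
          simpa using tendsto_const_nhds.inner (x := h) (hpure h)
    exact congrArg _ (tendsto_nhds_unique (f.tendsto_asymptoticLimit hX h1) hzero)

theorem hasSum_b_mul_norm_Delta_sq (hm : 1 ≤ m) (hX : X ∈ f.domain m H) (h : H) :
    HasSum (fun α => f.b m α * ‖f.Delta m X (adjoint (monomial X α) h)‖ ^ 2)
      (‖h‖ ^ 2 - (⟪h, f.asymptoticLimit X h⟫_ℂ).re) := by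
  have h1 := f.Phi_one_le_one hm hX
  have hle : (⟪h, f.asymptoticLimit X h⟫_ℂ).re ≤ ‖h‖ ^ 2 := by
    simpa [← Complex.ofReal_pow] using
      (Complex.le_def.1 (le_iff_inner_le.1 (f.asymptoticLimit_le_one hX.1 h1) h)).1
  have hterm (α : FreeMonoid (Fin n)) :
      0 ≤ f.b m α * ‖f.Delta m X (adjoint (monomial X α) h)‖ ^ 2 :=
    mul_nonneg (f.b_pos m α).le (sq_nonneg _)
  have norm_Delta_sq (g : H) : ‖f.Delta m X g‖ ^ 2 = (⟪g, f.defect X m g⟫_ℂ).re :=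
    norm_sqrt_apply_sq (f.defect_nonneg hX le_rfl) g
  have htsum := f.tsum_b_mul_ennrealForm_defect hm hX h (f.tendsto_re_inner_Phi_iterate hX.1 h1 h)
  simp only [ennrealForm, ← norm_Delta_sq,
    ← ENNReal.ofReal_mul (f.b_pos m _).le] at htsum
  have hsummable := ENNReal.summable_toReal (htsum.trans_ne ENNReal.ofReal_ne_top)
  simp only [ENNReal.toReal_ofReal (hterm _)] at hsummable
  rw [← ENNReal.ofReal_tsum_of_nonneg hterm hsummable,
    ENNReal.ofReal_eq_ofReal_iff (tsum_nonneg hterm) (sub_nonneg.2 hle)] at htsum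
  exact htsum ▸ hsummable.hasSum

end PosRegular

/-! ### The Poisson kernel -/

section HilbertTensor

variable {E E' E'' F : Type*} [NormedAddCommGroup E] [InnerProductSpace ℂ E]
  [NormedAddCommGroup E'] [InnerProductSpace ℂ E'] [NormedAddCommGroup E'']
  [InnerProductSpace ℂ E''] [NormedAddCommGroup F] [InnerProductSpace ℂ F]

/-- The map `e ↦ e ⊗ d` into the Hilbert space tensor product. -/
def tmulRight (E : Type*) [NormedAddCommGroup E] [InnerProductSpace ℂ E] (d : F) :
    E →L[ℂ] HilbertTensor E F :=
  UniformSpace.Completion.toComplL ∘L (TensorProduct.mkL ℂ E F).flip d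

/-- The operator `A ⊗ I_F` between Hilbert space tensor products, for `A` between two possibly
different spaces. -/
def tensorId (F : Type*) [NormedAddCommGroup F] [InnerProductSpace ℂ F] (A : E →L[ℂ] E') :
    HilbertTensor E F →L[ℂ] HilbertTensor E' F :=
  (A.rTensor F).completion

theorem inner_tmulRight (d d' : F) (e e' : E) :
    ⟪tmulRight E d e, tmulRight E d' e'⟫_ℂ = ⟪e, e'⟫_ℂ * ⟪d, d'⟫_ℂ :=
  (UniformSpace.Completion.inner_coe _ _).trans (TensorProduct.inner_tmul ℂ e e' d d')

theorem tensorId_comp_tmulRight (A : E →L[ℂ] E') (d : F) :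
    tensorId F A ∘L tmulRight E d = tmulRight E' d ∘L A := by
  ext e
  exact ContinuousLinearMap.completion_apply_coe _ _

theorem hilbertTensor_hom_ext {G : Type*} [NormedAddCommGroup G] [NormedSpace ℂ G]
    {A B : HilbertTensor E F →L[ℂ] G} (h : ∀ d, A ∘L tmulRight E d = B ∘L tmulRight E d) :
    A = B := by
  ext z
  induction z using UniformSpace.Completion.induction_on with
  | hp => exact isClosed_eq A.continuous B.continuous
  | ih z =>
    induction z using TensorProduct.induction_on with
    | zero => rw [UniformSpace.Completion.coe_zero, map_zero, map_zero]
    | tmul e d => exact DFunLike.congr_fun (h d) e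
    | add x y hx hy => rw [UniformSpace.Completion.coe_add, map_add, map_add, hx, hy]

theorem tensorId_comp (A : E' →L[ℂ] E'') (B : E →L[ℂ] E') :
    tensorId F (A ∘L B) = tensorId F A ∘L tensorId F B :=
  hilbertTensor_hom_ext fun d => by
    rw [ContinuousLinearMap.comp_assoc, tensorId_comp_tmulRight, tensorId_comp_tmulRight,
      ← ContinuousLinearMap.comp_assoc, ← ContinuousLinearMap.comp_assoc, tensorId_comp_tmulRight]

theorem adjoint_tensorId [CompleteSpace E] [CompleteSpace E'] (A : E →L[ℂ] E') :
    adjoint (tensorId F A) = tensorId F (adjoint A) := by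
  refine hilbertTensor_hom_ext fun d => ?_
  ext e
  refine ext_inner_right ℂ fun z => ?_
  have forms_eq : innerSL ℂ ((adjoint (tensorId F A) ∘L tmulRight E' d) e) =
      innerSL ℂ ((tensorId F (adjoint A) ∘L tmulRight E' d) e) := by
    refine hilbertTensor_hom_ext fun d' => ?_
    ext e'
    have hA := DFunLike.congr_fun (tensorId_comp_tmulRight A d') e'
    simp only [ContinuousLinearMap.comp_apply] at hA
    simp only [tensorId_comp_tmulRight, ContinuousLinearMap.comp_apply, innerSL_apply_apply,
      ContinuousLinearMap.adjoint_inner_left, inner_tmulRight, hA]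
  exact DFunLike.congr_fun forms_eq z

theorem norm_tensorId_apply [CompleteSpace E] [CompleteSpace E'] {A : E →L[ℂ] E'}
    (hA : adjoint A ∘L A = 1) (z : HilbertTensor E F) : ‖tensorId F A z‖ = ‖z‖ := by
  refine (ContinuousLinearMap.norm_map_iff_adjoint_comp_self _).2 ?_ z
  rw [adjoint_tensorId, ← tensorId_comp, hA]
  exact hilbertTensor_hom_ext fun d => tensorId_comp_tmulRight 1 d

section SquareSummable

variable {ι : Type*} {H : Type*} [NormedAddCommGroup H] [InnerProductSpace ℂ H]

/-- The operator column `h ↦ (R_i h)_i` of a pointwise square-summable family. -/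
def column (R : ι → H →L[ℂ] F) (hR : ∀ h, Summable fun i => ‖R i h‖ ^ 2) :
    H →ₗ[ℂ] lp (fun _ : ι => F) 2 where
  toFun h := ⟨fun i => R i h, memℓp_gen (by simpa using hR h)⟩
  map_add' g h := by ext i; exact map_add (R i) g h
  map_smul' c h := by ext i; exact map_smul (R i) c h

theorem norm_column_sq (R : ι → H →L[ℂ] F) (hR : ∀ h, Summable fun i => ‖R i h‖ ^ 2) (h : H) :
    ‖column R hR h‖ ^ 2 = ∑' i, ‖R i h‖ ^ 2 := by
  have hsum := lp.hasSum_norm (p := 2) (by norm_num) (column R hR h)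
  simp only [ENNReal.toReal_ofNat, Real.rpow_ofNat] at hsum
  exact hsum.tsum_eq.symm

variable [DecidableEq ι]

/-- The isometry `d ↦ e_i ⊗ d`, for `e_i` the `i`-th basis vector of `ℓ²`. -/
def basisTmul (F : Type*) [NormedAddCommGroup F] [InnerProductSpace ℂ F] (i : ι) :
    F →ₗᵢ[ℂ] HilbertTensor (lp (fun _ : ι => ℂ) 2) F where
  toFun d := tmulRight _ d (lp.single 2 i 1)
  map_add' d d' := by simp [tmulRight]
  map_smul' z d := by simp [tmulRight]
  norm_map' d := by
    change ‖((lp.single 2 i 1 ⊗ₜ[ℂ] d : lp (fun _ : ι => ℂ) 2 ⊗[ℂ] F) :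
      HilbertTensor (lp (fun _ : ι => ℂ) 2) F)‖ = ‖d‖
    rw [UniformSpace.Completion.norm_coe, TensorProduct.norm_tmul, lp.norm_single (by norm_num),
      norm_one, one_mul]

theorem orthogonalFamily_basisTmul :
    OrthogonalFamily ℂ (fun _ : ι => F) (basisTmul F : ι → _) := by
  intro i j hij d d'
  change ⟪tmulRight _ d (lp.single 2 i 1), tmulRight _ d' (lp.single 2 j 1)⟫_ℂ = 0
  rw [inner_tmulRight, lp.inner_single_left, lp.single_apply, Pi.single_apply, if_neg hij,
    inner_zero_right, zero_mul]

theorem inner_linearIsometry_basisTmul (x : lp (fun _ : ι => F) 2) (i : ι) (d : F) :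
    ⟪(orthogonalFamily_basisTmul (F := F)).linearIsometry x,
      tmulRight _ d (lp.single 2 i 1)⟫_ℂ = ⟪x i, d⟫_ℂ := by
  change ⟪_, basisTmul F i d⟫_ℂ = _
  rw [← OrthogonalFamily.linearIsometry_apply_single orthogonalFamily_basisTmul,
    LinearIsometry.inner_map_map, lp.inner_single_right]

end SquareSummable

end HilbertTensor

section RangeClosure

variable {H K : Type*} [NormedAddCommGroup H] [InnerProductSpace ℂ H] [NormedAddCommGroup K]
  [InnerProductSpace ℂ K]

/-- The operator `A`, viewed as an operator into the closure of its range. -/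
def toRangeClosure (A : H →L[ℂ] K) :
    H →L[ℂ] (LinearMap.range (A : H →ₗ[ℂ] K)).topologicalClosure :=
  A.codRestrict _ fun h => Submodule.le_topologicalClosure _ ⟨h, rfl⟩

theorem denseRange_toRangeClosure (A : H →L[ℂ] K) : DenseRange (toRangeClosure A) := by
  rintro ⟨x, hx⟩
  rw [closure_subtype, ← Set.range_comp]
  exact hx

end RangeClosure

namespace PosRegular

variable {n : ℕ} (f : PosRegular n) {m : ℕ}

theorem W_single (m : ℕ) (i : Fin n) (γ : FreeMonoid (Fin n)) :
    f.W m i (lp.single 2 γ 1) = (f.weight m i γ : ℂ) • lp.single 2 (FreeMonoid.of i * γ) 1 := by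
  ext α
  change f.shiftFun m i (lp.single 2 γ 1 : Fock n) α = _
  rw [lp.coeFn_smul, Pi.smul_apply, lp.single_apply, Pi.single_apply]
  by_cases h : ∃ β, FreeMonoid.of i * β = α
  · obtain ⟨β, rfl⟩ := h
    rw [shiftFun, (mul_right_injective (FreeMonoid.of i)).extend_apply, lp.single_apply,
      Pi.single_apply]
    by_cases hβ : β = γ <;> simp [hβ]
  · rw [shiftFun, Function.extend_apply' _ _ _ h, if_neg fun h' => h ⟨γ, h'.symm⟩]
    simp

theorem weight_mul_sqrt_b (m : ℕ) (i : Fin n) (γ : FreeMonoid (Fin n)) :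
    f.weight m i γ * √(f.b m (FreeMonoid.of i * γ)) = √(f.b m γ) := by
  rw [weight, Real.sqrt_div (f.b_pos m γ).le,
    div_mul_cancel₀ _ (Real.sqrt_ne_zero'.2 (f.b_pos m (FreeMonoid.of i * γ)))]

theorem starProjection_NQ_sub_mem_MQ (m : ℕ) (Q : Set (FreeAlgebra ℂ (Fin n))) (v : Fock n) :
    v - (f.NQ m Q).starProjection v ∈ f.MQ m Q := by
  have hmem := (f.NQ m Q).sub_starProjection_mem_orthogonal v
  rwa [show (f.NQ m Q)ᗮ = (f.MQ m Q)ᗮᗮ from rfl, Submodule.orthogonal_orthogonal_eq_closure,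
    IsClosed.submodule_topologicalClosure_eq (s := f.MQ m Q)
      (Submodule.isClosed_topologicalClosure _)] at hmem

variable {H : Type*} [NormedAddCommGroup H] [InnerProductSpace ℂ H]
  {T : Fin n → H →L[ℂ] H} {Q : Set (FreeAlgebra ℂ (Fin n))}

theorem apply_eq_zero_of_mem_MQ (hQ : ∀ q ∈ Q, polyEval T q = 0) {G : Fock n →L[ℂ] H}
    (hG : ∀ i, G ∘L f.W m i = T i ∘L G) {v : Fock n} (hv : v ∈ f.MQ m Q) : G v = 0 := by
  refine Submodule.topologicalClosure_minimal _ (t := LinearMap.ker G.toLinearMap)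
    (Submodule.span_le.2 ?_) (ContinuousLinearMap.isClosed_ker _) hv
  rintro _ ⟨q, hq, α, β, rfl⟩
  have hmonomial := DFunLike.congr_fun (comp_monomial_eq hG α)
  have hpoly := DFunLike.congr_fun (comp_polyEval_eq hG q)
  simp only [ContinuousLinearMap.comp_apply, hQ q hq, zero_apply] at hmonomial hpoly
  simp [hmonomial, hpoly]

variable [CompleteSpace H]

instance (m : ℕ) (T : Fin n → H →L[ℂ] H) : CompleteSpace (f.defectSpace m T) :=
  inferInstanceAs (CompleteSpace (LinearMap.range (f.Delta m T : H →ₗ[ℂ] H)).topologicalClosure)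

/-- The operator `Δ_{f,m,T}`, viewed as an operator into the closure `D` of its range. -/
def toDefectSpace (m : ℕ) (T : Fin n → H →L[ℂ] H) : H →L[ℂ] f.defectSpace m T :=
  toRangeClosure (f.Delta m T)

/-- The operator `√b_α Δ_{f,m,T} T_α^*` from `H` to `D`, the coordinate of the Poisson kernel at
the word `α`. -/
def poissonCoord (m : ℕ) (T : Fin n → H →L[ℂ] H) (α : FreeMonoid (Fin n)) :
    H →L[ℂ] f.defectSpace m T :=
  (√(f.b m α) : ℂ) • (f.toDefectSpace m T ∘L adjoint (monomial T α))

theorem hasSum_norm_poissonCoord_sq (hm : 1 ≤ m) (hT : T ∈ f.domain m H) (h : H) :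
    HasSum (fun α => ‖f.poissonCoord m T α h‖ ^ 2)
      (‖h‖ ^ 2 - (⟪h, f.asymptoticLimit T h⟫_ℂ).re) := by
  convert f.hasSum_b_mul_norm_Delta_sq hm hT h using 2 with α
  rw [poissonCoord, smul_apply, norm_smul, mul_pow, Complex.norm_real, Real.norm_eq_abs, sq_abs,
    Real.sq_sqrt (f.b_pos m α).le]
  rfl

/-- The noncommutative Poisson kernel `h ↦ ∑_α e_α ⊗ √b_α Δ_{f,m,T} T_α^* h`, with values in
`F²(Hₙ) ⊗ D`. -/
def poissonKernel (hm : 1 ≤ m) (hT : T ∈ f.domain m H) :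
    H →L[ℂ] HilbertTensor (Fock n) (f.defectSpace m T) :=
  (orthogonalFamily_basisTmul (F := f.defectSpace m T)).linearIsometry.toContinuousLinearMap ∘L
    (column (f.poissonCoord m T)
      fun h => (f.hasSum_norm_poissonCoord_sq hm hT h).summable).mkContinuous 1 fun h => by
        rw [one_mul]
        refine le_of_sq_le_sq ?_ (norm_nonneg h)
        rw [norm_column_sq, (f.hasSum_norm_poissonCoord_sq hm hT h).tsum_eq, sub_le_self_iff]
        exact re_inner_nonneg (f.asymptoticLimit_nonneg hT.1 (f.Phi_one_le_one hm hT)) h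

theorem norm_poissonKernel_sq (hm : 1 ≤ m) (hT : T ∈ f.domain m H) (h : H) :
    ‖f.poissonKernel hm hT h‖ ^ 2 = ‖h‖ ^ 2 - (⟪h, f.asymptoticLimit T h⟫_ℂ).re := by
  have hsum := f.hasSum_norm_poissonCoord_sq hm hT
  rw [← (hsum h).tsum_eq, ← norm_column_sq _ fun h => (hsum h).summable, poissonKernel,
    ContinuousLinearMap.comp_apply, LinearIsometry.coe_toContinuousLinearMap,
    LinearIsometry.norm_map]
  rfl

theorem adjoint_poissonKernel_tmulRight (hm : 1 ≤ m) (hT : T ∈ f.domain m H)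
    (d : f.defectSpace m T) (α : FreeMonoid (Fin n)) :
    adjoint (f.poissonKernel hm hT) (tmulRight _ d (lp.single 2 α 1)) =
      (√(f.b m α) : ℂ) • monomial T α (adjoint (f.toDefectSpace m T) d) := by
  refine ext_inner_left ℂ fun h => ?_
  rw [ContinuousLinearMap.adjoint_inner_right]
  refine (inner_linearIsometry_basisTmul _ α d).trans ?_
  change ⟪f.poissonCoord m T α h, d⟫_ℂ = _
  rw [poissonCoord, smul_apply, inner_smul_left, inner_smul_right, Complex.conj_ofReal,
    ContinuousLinearMap.comp_apply, ← ContinuousLinearMap.adjoint_inner_right,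
    ContinuousLinearMap.adjoint_inner_left]

theorem adjoint_poissonKernel_comp (hm : 1 ≤ m) (hT : T ∈ f.domain m H) (i : Fin n) :
    adjoint (f.poissonKernel hm hT) ∘L tensorId _ (f.W m i) =
      T i ∘L adjoint (f.poissonKernel hm hT) := by
  refine hilbertTensor_hom_ext fun d =>
    lp.ext_continuousLinearMap (by norm_num) fun γ => ContinuousLinearMap.ext_ring ?_
  change adjoint (f.poissonKernel hm hT)
      ((tensorId _ (f.W m i) ∘L tmulRight _ d) (lp.single 2 γ 1)) = _
  rw [tensorId_comp_tmulRight]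
  change adjoint (f.poissonKernel hm hT) (tmulRight _ d (f.W m i (lp.single 2 γ 1))) =
    T i (adjoint (f.poissonKernel hm hT) (tmulRight _ d (lp.single 2 γ 1)))
  rw [W_single, map_smul, map_smul, adjoint_poissonKernel_tmulRight,
    adjoint_poissonKernel_tmulRight, map_smul, smul_smul, ← Complex.ofReal_mul,
    weight_mul_sqrt_b, monomial_mul, monomial_of]
  rfl

theorem tensorId_starProjection_comp_poissonKernel (hm : 1 ≤ m) (hT : T ∈ f.domain m H)
    (hQ : ∀ q ∈ Q, polyEval T q = 0) :
    tensorId _ (f.NQ m Q).starProjection ∘L f.poissonKernel hm hT = f.poissonKernel hm hT := by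
  refine ContinuousLinearMap.adjoint.injective ?_
  rw [ContinuousLinearMap.adjoint_comp, adjoint_tensorId,
    (isSelfAdjoint_starProjection (f.NQ m Q)).adjoint_eq]
  refine hilbertTensor_hom_ext fun d => ?_
  rw [ContinuousLinearMap.comp_assoc, tensorId_comp_tmulRight, ← ContinuousLinearMap.comp_assoc]
  have hG (i : Fin n) : (adjoint (f.poissonKernel hm hT) ∘L tmulRight _ d) ∘L f.W m i =
      T i ∘L adjoint (f.poissonKernel hm hT) ∘L tmulRight _ d := by
    rw [ContinuousLinearMap.comp_assoc, ← tensorId_comp_tmulRight,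
      ← ContinuousLinearMap.comp_assoc, adjoint_poissonKernel_comp, ContinuousLinearMap.comp_assoc]
  ext v
  have hzero := f.apply_eq_zero_of_mem_MQ hQ hG (f.starProjection_NQ_sub_mem_MQ m Q v)
  rw [map_sub, sub_eq_zero] at hzero
  exact hzero.symm

/-- The constrained Poisson kernel of a tuple `T` in the variety: the Poisson kernel with its
values compressed to `N_Q ⊗ D`. -/
def constrainedPoissonKernel (Q : Set (FreeAlgebra ℂ (Fin n))) (hm : 1 ≤ m)
    (hT : T ∈ f.domain m H) : H →L[ℂ] HilbertTensor (f.NQ m Q) (f.defectSpace m T) :=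
  tensorId _ (f.NQ m Q).orthogonalProjectionOnto ∘L f.poissonKernel hm hT

theorem tensorId_subtypeL_comp_constrainedPoissonKernel (hm : 1 ≤ m) (hT : T ∈ f.domain m H)
    (hQ : ∀ q ∈ Q, polyEval T q = 0) :
    tensorId _ (f.NQ m Q).subtypeL ∘L f.constrainedPoissonKernel Q hm hT =
      f.poissonKernel hm hT := by
  rw [constrainedPoissonKernel, ← ContinuousLinearMap.comp_assoc, ← tensorId_comp]
  exact f.tensorId_starProjection_comp_poissonKernel hm hT hQ

theorem norm_constrainedPoissonKernel_sq (hm : 1 ≤ m) (hT : T ∈ f.domain m H)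
    (hQ : ∀ q ∈ Q, polyEval T q = 0) (h : H) :
    ‖f.constrainedPoissonKernel Q hm hT h‖ ^ 2 =
      ‖h‖ ^ 2 - (⟪h, f.asymptoticLimit T h⟫_ℂ).re := by
  have isometry : adjoint (f.NQ m Q).subtypeL ∘L (f.NQ m Q).subtypeL = 1 :=
    (ContinuousLinearMap.norm_map_iff_adjoint_comp_self _).1 fun _ => rfl
  rw [← f.norm_poissonKernel_sq hm hT, ← f.tensorId_subtypeL_comp_constrainedPoissonKernel hm hT hQ,
    ContinuousLinearMap.comp_apply, norm_tensorId_apply isometry]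

theorem adjoint_ampliation_B_comp_constrainedPoissonKernel (hm : 1 ≤ m) (hT : T ∈ f.domain m H)
    (hQ : ∀ q ∈ Q, polyEval T q = 0) (i : Fin n) :
    adjoint (ampliation (f.defectSpace m T) (f.B m Q i)) ∘L f.constrainedPoissonKernel Q hm hT =
      f.constrainedPoissonKernel Q hm hT ∘L adjoint (T i) := by
  have adjoint_B : adjoint (f.B m Q i) =
      ((f.NQ m Q).orthogonalProjectionOnto ∘L adjoint (f.W m i)) ∘L (f.NQ m Q).subtypeL := by
    rw [B, ContinuousLinearMap.adjoint_comp, ContinuousLinearMap.adjoint_comp,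
      Submodule.adjoint_subtypeL, Submodule.adjoint_orthogonalProjectionOnto]
  have adjoint_W_comp : tensorId _ (adjoint (f.W m i)) ∘L f.poissonKernel hm hT =
      f.poissonKernel hm hT ∘L adjoint (T i) := by
    have h := congrArg adjoint (f.adjoint_poissonKernel_comp hm hT i)
    rwa [ContinuousLinearMap.adjoint_comp, ContinuousLinearMap.adjoint_comp,
      ContinuousLinearMap.adjoint_adjoint, adjoint_tensorId] at h
  change adjoint (tensorId _ (f.B m Q i)) ∘L _ = _
  rw [adjoint_tensorId, adjoint_B, tensorId_comp, ContinuousLinearMap.comp_assoc,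
    f.tensorId_subtypeL_comp_constrainedPoissonKernel hm hT hQ, tensorId_comp,
    ContinuousLinearMap.comp_assoc, adjoint_W_comp, ← ContinuousLinearMap.comp_assoc]
  rfl

end PosRegular

/-! ### Direct sums and operators determined on a dense range -/

section DirectSum

variable {H E K : Type*} [NormedAddCommGroup H] [InnerProductSpace ℂ H] [NormedAddCommGroup E]
  [InnerProductSpace ℂ E] [NormedAddCommGroup K] [InnerProductSpace ℂ K]

/-- The isometry `h ↦ (A h, B h)` into the Hilbert space direct sum. -/
def directSumIsometry (A : H →L[ℂ] E) (B : H →L[ℂ] K)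
    (hAB : ∀ h, ‖A h‖ ^ 2 + ‖B h‖ ^ 2 = ‖h‖ ^ 2) : H →ₗᵢ[ℂ] WithLp 2 (E × K) where
  toLinearMap :=
    (WithLp.linearEquiv 2 ℂ (E × K)).symm.toLinearMap ∘ₗ A.toLinearMap.prod B.toLinearMap
  norm_map' h := by
    rw [← sq_eq_sq₀ (norm_nonneg _) (norm_nonneg _), WithLp.prod_norm_sq_eq_of_L2]
    change ‖A h‖ ^ 2 + ‖B h‖ ^ 2 = _
    exact hAB h

variable [CompleteSpace E] [CompleteSpace K]

theorem adjoint_directSum (A : E →L[ℂ] E) (U : K →L[ℂ] K) :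
    adjoint (directSum A U) = directSum (adjoint A) (adjoint U) := by
  refine ((ContinuousLinearMap.eq_adjoint_iff _ _).2 fun x y => ?_).symm
  rw [WithLp.prod_inner_apply, WithLp.prod_inner_apply]
  change ⟪adjoint A x.fst, y.fst⟫_ℂ + ⟪adjoint U x.snd, y.snd⟫_ℂ =
    ⟪x.fst, A y.fst⟫_ℂ + ⟪x.snd, U y.snd⟫_ℂ
  rw [ContinuousLinearMap.adjoint_inner_left, ContinuousLinearMap.adjoint_inner_left]

theorem adjoint_directSum_directSumIsometry {A : H →L[ℂ] E} {B : H →L[ℂ] K}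
    (hAB : ∀ h, ‖A h‖ ^ 2 + ‖B h‖ ^ 2 = ‖h‖ ^ 2) {V : E →L[ℂ] E} {U : K →L[ℂ] K}
    {R : H →L[ℂ] H} (hV : adjoint V ∘L A = A ∘L R) (hU : adjoint U ∘L B = B ∘L R) (h : H) :
    adjoint (directSum V U) (directSumIsometry A B hAB h) = directSumIsometry A B hAB (R h) := by
  rw [adjoint_directSum]
  change WithLp.toLp 2 ((adjoint V ∘L A) h, (adjoint U ∘L B) h) = WithLp.toLp 2 (A (R h), B (R h))
  rw [hV, hU]
  rfl

end DirectSum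

section DenseRange

variable {H K : Type*} [NormedAddCommGroup H] [InnerProductSpace ℂ H] [CompleteSpace H]
  [NormedAddCommGroup K] [InnerProductSpace ℂ K] [CompleteSpace K] {Y : H →L[ℂ] K}

theorem le_of_adjoint_conj_le (hY : DenseRange Y) {A B : K →L[ℂ] K}
    (h : adjoint Y ∘L A ∘L Y ≤ adjoint Y ∘L B ∘L Y) : A ≤ B := by
  refine le_iff_inner_le.2 fun x => ?_
  induction x using hY.induction_on with
  | hp => exact isClosed_le (by fun_prop) (by fun_prop)
  | ih x =>
    simpa only [ContinuousLinearMap.comp_apply, ContinuousLinearMap.adjoint_inner_right]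
      using le_iff_inner_le.1 h x

theorem eq_of_adjoint_conj_eq (hY : DenseRange Y) {A B : K →L[ℂ] K}
    (h : adjoint Y ∘L A ∘L Y = adjoint Y ∘L B ∘L Y) : A = B :=
  le_antisymm (le_of_adjoint_conj_le hY h.le) (le_of_adjoint_conj_le hY h.ge)

/-- The operator `U` on `K` with `U^* Y = Y A^*`, for `Y` with dense range. It is meaningful when
`‖Y A^* h‖` is dominated by a multiple of `‖Y h‖`. -/
def inducedOperator (Y : H →L[ℂ] K) (A : H →L[ℂ] H) : K →L[ℂ] K :=
  adjoint (LinearMap.extendOfNorm (Y ∘L adjoint A : H →L[ℂ] K).toLinearMap Y.toLinearMap)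

theorem adjoint_inducedOperator_comp (hY : DenseRange Y) {A : H →L[ℂ] H} {c : ℝ}
    (hA : A * (adjoint Y ∘L Y) * adjoint A ≤ c • (adjoint Y ∘L Y)) :
    adjoint (inducedOperator Y A) ∘L Y = Y ∘L adjoint A := by
  have norm_sq_le (h : H) : ‖Y (adjoint A h)‖ ^ 2 ≤ c * ‖Y h‖ ^ 2 := by
    have hle := (Complex.le_def.1 (le_iff_inner_le.1 hA h)).1
    rw [ContinuousLinearMap.apply_norm_sq_eq_inner_adjoint_right,
      ContinuousLinearMap.apply_norm_sq_eq_inner_adjoint_right,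
      ContinuousLinearMap.adjoint_inner_left]
    simpa [inner_smul_right] using hle
  have norm_le (h : H) : ‖Y (adjoint A h)‖ ≤ √c * ‖Y h‖ := by
    rw [← Real.sqrt_sq (norm_nonneg (Y (adjoint A h))), ← Real.sqrt_sq (norm_nonneg (Y h)),
      ← Real.sqrt_mul' c (sq_nonneg _)]
    exact Real.sqrt_le_sqrt (norm_sq_le h)
  ext h
  rw [inducedOperator, ContinuousLinearMap.adjoint_adjoint]
  exact LinearMap.extendOfNorm_eq hY ⟨√c, norm_le⟩ h

end DenseRange

namespace PosRegular

variable {n : ℕ} (f : PosRegular n) {m : ℕ} {H : Type*} [NormedAddCommGroup H]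
  [InnerProductSpace ℂ H] [CompleteSpace H] {T : Fin n → H →L[ℂ] H}

theorem defect_eq_zero_of_Phi_one (hT : f.Phi T 1 = 1) {k : ℕ} (hk : 1 ≤ k) :
    f.defect T k = 0 := by
  obtain ⟨j, rfl⟩ := Nat.exists_eq_add_of_le' hk
  have Phi_zero : f.Phi T 0 = 0 := by simp [Phi, PhiTerm]
  rw [defect, Function.iterate_succ_apply, hT, sub_self]
  exact Function.iterate_fixed (by rw [Phi_zero, sub_zero]) j

section Intertwining

variable {K : Type*} [NormedAddCommGroup K] [InnerProductSpace ℂ K] [CompleteSpace K]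
  {U : Fin n → K →L[ℂ] K} {Y : H →L[ℂ] K}

theorem adjoint_conj_PhiTerm (hU : ∀ i, adjoint Y ∘L U i = T i ∘L adjoint Y) (Z : K →L[ℂ] K)
    (α : FreeMonoid (Fin n)) :
    adjoint Y ∘L (f.PhiTerm U Z α).toCLM ∘L Y =
      (f.PhiTerm T (adjoint Y ∘L Z ∘L Y) α).toCLM := by
  have hα := comp_monomial_eq hU α
  have hα' := congrArg adjoint hα
  rw [ContinuousLinearMap.adjoint_comp, ContinuousLinearMap.adjoint_comp,
    ContinuousLinearMap.adjoint_adjoint] at hα'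
  ext h
  have hα_apply := DFunLike.congr_fun hα
  have hα'_apply := DFunLike.congr_fun hα'
  simp only [ContinuousLinearMap.comp_apply] at hα_apply hα'_apply
  simp [PhiTerm, ContinuousLinearMap.star_eq_adjoint, hα_apply, hα'_apply]

theorem summable_PhiTerm_one_of_intertwining (hY : DenseRange Y)
    (hU : ∀ i, adjoint Y ∘L U i = T i ∘L adjoint Y) (hT : Summable (f.PhiTerm T 1))
    (hΦ : f.Phi T (adjoint Y ∘L Y) ≤ adjoint Y ∘L Y) : Summable (f.PhiTerm U 1) := by
  have hYY : 0 ≤ adjoint Y ∘L Y :=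
    ContinuousLinearMap.nonneg_iff_isPositive _ |>.2 Y.isPositive_adjoint_comp_self
  refine summable_wot_of_sum_le (f.PhiTerm_nonneg U zero_le_one) (B := 1) fun s =>
    le_of_adjoint_conj_le hY ?_
  calc adjoint Y ∘L (∑ α ∈ s, (f.PhiTerm U 1 α).toCLM) ∘L Y
      = ∑ α ∈ s, (f.PhiTerm T (adjoint Y ∘L Y) α).toCLM := by
        rw [ContinuousLinearMap.finsetSum_comp, ContinuousLinearMap.comp_finsetSum]
        exact Finset.sum_congr rfl fun α _ => f.adjoint_conj_PhiTerm hU 1 α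
    _ ≤ adjoint Y ∘L Y := (f.sum_PhiTerm_le_Phi hT hYY s).trans hΦ

theorem adjoint_conj_Phi (hU : ∀ i, adjoint Y ∘L U i = T i ∘L adjoint Y)
    (hU1 : Summable (f.PhiTerm U 1)) (hT : Summable (f.PhiTerm T 1)) (Z : K →L[ℂ] K) :
    adjoint Y ∘L f.Phi U Z ∘L Y = f.Phi T (adjoint Y ∘L Z ∘L Y) := by
  have hsum : HasSum (f.PhiTerm T (adjoint Y ∘L Z ∘L Y))
      (.ofCLM (adjoint Y ∘L f.Phi U Z ∘L Y)) := by
    refine hasSum_wot_iff_inner_self.2 fun h => ?_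
    have hsum_U := hasSum_wot_iff_inner_self.1 (f.hasSum_PhiTerm hU1 Z) (Y h)
    simp only [← ContinuousLinearMapWOT.toCLM_apply, ← f.adjoint_conj_PhiTerm hU,
      ContinuousLinearMap.comp_apply, ContinuousLinearMap.adjoint_inner_right] at hsum_U ⊢
    exact hsum_U
  exact congrArg ContinuousLinearMapWOT.toCLM (hsum.unique (f.hasSum_PhiTerm hT _))

end Intertwining

end PosRegular

/-! ### The residual part -/

namespace PosRegular

variable {n : ℕ} (f : PosRegular n) {m : ℕ} {H : Type*} [NormedAddCommGroup H]
  [InnerProductSpace ℂ H] [CompleteSpace H] {T : Fin n → H →L[ℂ] H}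

/-- The space `K` of the residual part of `T`: the closure of the range of `S^{1/2}`, where `S` is
the limit of `Φ_{f,T}^k(I)`. -/
def residualSpace (T : Fin n → H →L[ℂ] H) : Submodule ℂ H :=
  (LinearMap.range (CFC.sqrt (f.asymptoticLimit T)).toLinearMap).topologicalClosure

instance (T : Fin n → H →L[ℂ] H) : CompleteSpace (f.residualSpace T) :=
  (Submodule.isClosed_topologicalClosure _).completeSpace_coe

/-- The operator `S^{1/2}`, viewed as an operator into the residual space. -/
def toResidualSpace (T : Fin n → H →L[ℂ] H) : H →L[ℂ] f.residualSpace T :=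
  toRangeClosure (CFC.sqrt (f.asymptoticLimit T))

/-- The residual part `U` of `T`, determined by `U_i^* S^{1/2} = S^{1/2} T_i^*`. -/
def residualPart (T : Fin n → H →L[ℂ] H) (i : Fin n) : f.residualSpace T →L[ℂ] f.residualSpace T :=
  inducedOperator (f.toResidualSpace T) (T i)

theorem denseRange_toResidualSpace (T : Fin n → H →L[ℂ] H) : DenseRange (f.toResidualSpace T) :=
  denseRange_toRangeClosure _

section Contractive

variable (hT : Summable (f.PhiTerm T 1)) (h1 : f.Phi T 1 ≤ 1)

include hT h1

theorem norm_toResidualSpace_sq (h : H) :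
    ‖f.toResidualSpace T h‖ ^ 2 = (⟪h, f.asymptoticLimit T h⟫_ℂ).re :=
  norm_sqrt_apply_sq (f.asymptoticLimit_nonneg hT h1) h

theorem adjoint_toResidualSpace_comp_self :
    adjoint (f.toResidualSpace T) ∘L f.toResidualSpace T = f.asymptoticLimit T := by
  have hS := f.asymptoticLimit_nonneg hT h1
  ext h
  refine ext_inner_left ℂ fun g => ?_
  rw [ContinuousLinearMap.comp_apply, ContinuousLinearMap.adjoint_inner_right]
  change ⟪CFC.sqrt (f.asymptoticLimit T) g, CFC.sqrt (f.asymptoticLimit T) h⟫_ℂ = _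
  rw [← ContinuousLinearMap.adjoint_inner_right,
    (IsSelfAdjoint.of_nonneg (CFC.sqrt_nonneg (f.asymptoticLimit T))).adjoint_eq,
    ← mul_apply_eq_comp, CFC.sqrt_mul_sqrt_self _ hS]

theorem mul_asymptoticLimit_mul_adjoint_le (i : Fin n) :
    T i * f.asymptoticLimit T * adjoint (T i) ≤
      (f.coeff (FreeMonoid.of i))⁻¹ • f.asymptoticLimit T := by
  have hle := f.sum_PhiTerm_le_Phi hT (f.asymptoticLimit_nonneg hT h1) {FreeMonoid.of i}
  rw [Finset.sum_singleton, f.Phi_asymptoticLimit hT h1] at hle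
  have hscaled := smul_le_smul_of_nonneg_left hle (inv_nonneg.2 (f.coeff_nonneg (FreeMonoid.of i)))
  simpa [PhiTerm, ContinuousLinearMap.star_eq_adjoint, ← Complex.coe_smul,
    (f.coeff_of_pos i).ne'] using hscaled

theorem adjoint_residualPart_comp (i : Fin n) :
    adjoint (f.residualPart T i) ∘L f.toResidualSpace T =
      f.toResidualSpace T ∘L adjoint (T i) := by
  refine adjoint_inducedOperator_comp (f.denseRange_toResidualSpace T)
    (c := (f.coeff (FreeMonoid.of i))⁻¹) ?_
  rw [f.adjoint_toResidualSpace_comp_self hT h1]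
  exact f.mul_asymptoticLimit_mul_adjoint_le hT h1 i

theorem adjoint_toResidualSpace_comp_residualPart (i : Fin n) :
    adjoint (f.toResidualSpace T) ∘L f.residualPart T i =
      T i ∘L adjoint (f.toResidualSpace T) := by
  have h := congrArg adjoint (f.adjoint_residualPart_comp hT h1 i)
  rwa [ContinuousLinearMap.adjoint_comp, ContinuousLinearMap.adjoint_comp,
    ContinuousLinearMap.adjoint_adjoint, ContinuousLinearMap.adjoint_adjoint] at h

theorem summable_PhiTerm_residualPart : Summable (f.PhiTerm (f.residualPart T) 1) := by
  refine f.summable_PhiTerm_one_of_intertwining (f.denseRange_toResidualSpace T)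
    (f.adjoint_toResidualSpace_comp_residualPart hT h1) hT ?_
  rw [f.adjoint_toResidualSpace_comp_self hT h1, f.Phi_asymptoticLimit hT h1]

theorem Phi_residualPart_one : f.Phi (f.residualPart T) 1 = 1 := by
  have adjoint_conj_one : adjoint (f.toResidualSpace T) ∘L 1 ∘L f.toResidualSpace T =
      f.asymptoticLimit T := f.adjoint_toResidualSpace_comp_self hT h1
  refine eq_of_adjoint_conj_eq (f.denseRange_toResidualSpace T) ?_
  rw [f.adjoint_conj_Phi (f.adjoint_toResidualSpace_comp_residualPart hT h1)
    (f.summable_PhiTerm_residualPart hT h1) hT, adjoint_conj_one, f.Phi_asymptoticLimit hT h1]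

theorem polyEval_residualPart {q : FreeAlgebra ℂ (Fin n)} (hq : polyEval T q = 0) :
    polyEval (f.residualPart T) q = 0 := by
  refine eq_of_adjoint_conj_eq (f.denseRange_toResidualSpace T) ?_
  rw [← ContinuousLinearMap.comp_assoc,
    comp_polyEval_eq (f.adjoint_toResidualSpace_comp_residualPart hT h1), hq]
  simp

theorem subsingleton_residualSpace_iff_isPure : Subsingleton (f.residualSpace T) ↔ f.IsPure T := by
  rw [← f.asymptoticLimit_eq_zero_iff_isPure hT h1]
  refine ⟨fun _ => ?_, fun hS => ?_⟩
  · rw [← f.adjoint_toResidualSpace_comp_self hT h1, Subsingleton.elim (f.toResidualSpace T) 0,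
      ContinuousLinearMap.comp_zero]
  · rw [Submodule.subsingleton_iff_eq_bot, residualSpace, hS, CFC.sqrt_zero]
    simp

end Contractive

theorem residualPart_mem_variety (hm : 1 ≤ m) {Q : Set (FreeAlgebra ℂ (Fin n))}
    (hT : T ∈ f.variety m Q H) : f.residualPart T ∈ f.variety m Q (f.residualSpace T) := by
  have h1 := f.Phi_one_le_one hm hT.1
  refine ⟨⟨f.summable_PhiTerm_residualPart hT.1.1 h1, fun k hk _ => ?_⟩,
    fun q hq => f.polyEval_residualPart hT.1.1 h1 (hT.2 q hq)⟩
  rw [f.defect_eq_zero_of_Phi_one (f.Phi_residualPart_one hT.1.1 h1) hk]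

theorem norm_constrainedPoissonKernel_sq_add_norm_toResidualSpace_sq (hm : 1 ≤ m)
    {Q : Set (FreeAlgebra ℂ (Fin n))} (hT : T ∈ f.variety m Q H) (h : H) :
    ‖f.constrainedPoissonKernel Q hm hT.1 h‖ ^ 2 + ‖f.toResidualSpace T h‖ ^ 2 = ‖h‖ ^ 2 := by
  rw [f.norm_constrainedPoissonKernel_sq hm hT.1 hT.2,
    f.norm_toResidualSpace_sq hT.1.1 (f.Phi_one_le_one hm hT.1), sub_add_cancel]

/-- The isometry that embeds `H` into `(N_Q ⊗ D) ⊕ K` by the constrained Poisson kernel and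
`S^{1/2}`. -/
def dilationIsometry (hm : 1 ≤ m) {Q : Set (FreeAlgebra ℂ (Fin n))} (hT : T ∈ f.variety m Q H) :
    H →ₗᵢ[ℂ] f.DilationSpace m Q T (f.residualSpace T) :=
  directSumIsometry (E := HilbertTensor (f.NQ m Q) (f.defectSpace m T)) (K := f.residualSpace T)
    (f.constrainedPoissonKernel Q hm hT.1) (f.toResidualSpace T)
    (f.norm_constrainedPoissonKernel_sq_add_norm_toResidualSpace_sq hm hT)

theorem adjoint_dilation_dilationIsometry (hm : 1 ≤ m) {Q : Set (FreeAlgebra ℂ (Fin n))}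
    (hT : T ∈ f.variety m Q H) (i : Fin n) (h : H) :
    adjoint (𝕜 := ℂ) (f.dilation m Q T (f.residualPart T) i) (f.dilationIsometry hm hT h) =
      f.dilationIsometry hm hT (adjoint (T i) h) :=
  adjoint_directSum_directSumIsometry _
    (f.adjoint_ampliation_B_comp_constrainedPoissonKernel hm hT.1 hT.2 i)
    (f.adjoint_residualPart_comp hT.1.1 (f.Phi_one_le_one hm hT.1) i) h

end PosRegular

end NCVariety

end

theorem theorem6p1_general {n m : ℕ} (hm : 1 ≤ m)
    {H : Type u} [NormedAddCommGroup H] [InnerProductSpace ℂ H] [CompleteSpace H]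
    (f : NCVariety.PosRegular n) (Q : Set (FreeAlgebra ℂ (Fin n)))
    (T : Fin n → H →L[ℂ] H) (hT : T ∈ f.variety m Q H) :
    ∃ (K : Type u) (_ : NormedAddCommGroup K) (_ : InnerProductSpace ℂ K) (_ : CompleteSpace K)
      (U : Fin n → K →L[ℂ] K) (J : H →ₗᵢ[ℂ] f.DilationSpace m Q T K),
      U ∈ f.variety m Q K ∧
      f.Phi U 1 = 1 ∧
      (∀ i, ∀ x ∈ Set.range J,
        ContinuousLinearMap.adjoint (𝕜 := ℂ) (f.dilation m Q T U i) x ∈ Set.range J) ∧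
      (∀ i h, ContinuousLinearMap.adjoint (𝕜 := ℂ) (f.dilation m Q T U i) (J h) =
        J (ContinuousLinearMap.adjoint (T i) h)) ∧
      (Subsingleton K ↔ f.IsPure T) := by
  have h1 := f.Phi_one_le_one hm hT.1
  have intertwines := f.adjoint_dilation_dilationIsometry hm hT
  refine ⟨f.residualSpace T, inferInstance, inferInstance, inferInstance, f.residualPart T,
    f.dilationIsometry hm hT, f.residualPart_mem_variety hm hT,
    f.Phi_residualPart_one hT.1.1 h1, ?_, intertwines,
    f.subsingleton_residualSpace_iff_isPure hT.1.1 h1⟩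
  rintro i _ ⟨h, rfl⟩
  exact ⟨_, (intertwines i h).symm⟩

theorem theorem6p1 {n m : ℕ} (hn : 1 ≤ n) (hm : 1 ≤ m)
    {H : Type u} [NormedAddCommGroup H] [InnerProductSpace ℂ H] [CompleteSpace H]
    (f : NCVariety.PosRegular n) {ρ : ℝ} (hρ : 0 < ρ) (hf : f.IsFreeHolomorphicOn H ρ)
    (Q : Set (FreeAlgebra ℂ (Fin n))) (hQ : f.NQ m Q ≠ ⊥)
    (T : Fin n → H →L[ℂ] H) (hT : T ∈ f.variety m Q H) :
    ∃ (K : Type u) (_ : NormedAddCommGroup K) (_ : InnerProductSpace ℂ K) (_ : CompleteSpace K)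
      (U : Fin n → K →L[ℂ] K) (J : H →ₗᵢ[ℂ] f.DilationSpace m Q T K),
      U ∈ f.variety m Q K ∧
      f.Phi U 1 = 1 ∧
      (∀ i, ∀ x ∈ Set.range J,
        ContinuousLinearMap.adjoint (𝕜 := ℂ) (f.dilation m Q T U i) x ∈ Set.range J) ∧
      (∀ i h, ContinuousLinearMap.adjoint (𝕜 := ℂ) (f.dilation m Q T U i) (J h) =
        J (ContinuousLinearMap.adjoint (T i) h)) ∧
      (Subsingleton K ↔ f.IsPure T) :=
  theorem6p1_general hm f Q T hT
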